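/- A \emph{circle-$k$-gon} is the closed region of a disc lying between $m$ chords of its bounding circle, for some $1\le m\le k$, where the chords do not cross, no chord separates two others, and the sides of the region are alternatingly chords and arcs of the circle: going once around the circle one meets points $s_1,t_1,s_2,t_2,\dots,s_m,t_m$, the region has the arcs from $s_i$ to $t_i$ as arc sides and the chords from $t_i$ to $s_{i+1}$ (indices modulo $m$, $t_i\ne s_{i+1}$) as chord sides; arcs may degenerate to points ($s_i=t_i$), i.e. consecutive chords may share an endpoint. (For $m=1$ the region is one of the two circular segments bounded by the chord.) A \emph{circle-$k$-gon graph} is the intersection graph of a finite family of circle-$k$-gons in one circle; a \emph{circle-$k$-gon graph plus isolated vertices} is a graph obtained from a circle-$k$-gon graph by adding finitely many (possibly no) isolated vertices. For $L\subseteq\{0,1\}^*$ let $\langle L\rangle$ consist of the words of $L$ and of those obtained from them by exchanging $0$ and $1$; $L$ is $0$-$1$-symmetric if $L=\langle L\rangle$. For a $0$-$1$-symmetric $L$, let $\mathcal G_L$ be the class of all finite simple graphs $G=(V,E)$ for which there is a word $w\in V^*$ in which every vertex occurs and such that, for all distinct $u,v\in V$, $\{u,v\}\in E$ if and only if $h_{u,v}(w)\in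 L$, where $h_{u,v}$ is the morphism with $u\mapsto 0$, $v\mapsto 1$ that erases all other letters. Let $|w|_a$ be the number of occurrences of $a$ in $w$. \textbf{Theorem.} For $k\ge 1$, let $L^{\text{c-gon}}_k$ be the set of all $w\in\{0,1\}^*$ such that $2\le |w|_0\le 2k+1$, $2\le |w|_1\le 2k+1$, and \begin{itemize} \item if $|w|_0$ is odd and $|w|_1$ is even, then $w\notin (00)^+(11)^*0^+$; \item if $|w|_0$ is even and $|w|_1$ is odd, then $w\notin (11)^+(00)^*1^+$; \item if $|w|_0$ and $|w|_1$ are even, then $w\notin\langle (00)^+1^*0^*\rangle$ \end{itemize} (no further condition if both are odd). Then $L^{\text{c-gon}}_k$ is finite and $0$-$1$-symmetric, and $\mathcal G_{L^{\text{c-gon}}_k}$ is exactly the class of circle-$k$-gon graphs plus isolated vertices. Moreover, the class of circle-$k$-gon graphs has factorial speed: there are constants $c_1,c_2>0$ (depending on $k$) such that for every $n\ge1$ the number of circle-$k$-gon graphs with vertex set $\{1,\dots,n\}$ is at least $n^{c_1n}$ and at most $n^{c_2n}$. -/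

import Mathlib

open scoped Computability

universe u

/-! ### Words, languages and the graphs they represent -/

/-- The morphism `h_{a,b} : V* → {0,1}*` with `a ↦ 0`, `b ↦ 1` and `x ↦ λ` otherwise. -/
def pairProjection {V : Type u} [DecidableEq V] (a b : V) (w : List V) : List (Fin 2) :=
  w.flatMap fun x => if x = a then [0] else if x = b then [1] else []

/-- The complement morphism on binary words, exchanging `0` and `1`. -/
def complementWord (w : List (Fin 2)) : List (Fin 2) :=
  w.map fun x => if x = 0 then 1 else 0

/-- `⟨L⟩`: the words of `L` together with their complements. -/
def symmClosure (L : Language (Fin 2)) : Language (Fin 2) :=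
  {w | ∃ x ∈ L, w = x ∨ w = complementWord x}

/-- `L` is `0`-`1`-symmetric if `L = ⟨L⟩`. -/
def IsZeroOneSymmetric (L : Language (Fin 2)) : Prop :=
  L = symmClosure L

open Classical in
/-- `G` is `L`-represented by the word `w`, whose alphabet is exactly the vertex set. -/
def IsRepresentedBy {V : Type u} (L : Language (Fin 2)) (G : SimpleGraph V) (w : List V) : Prop :=
  (∀ v : V, v ∈ w) ∧ ∀ a b : V, a ≠ b → (G.Adj a b ↔ pairProjection a b w ∈ L)

/-- Membership in the graph class of all `L`-representable graphs. -/
def IsRepresentable {V : Type u} (L : Language (Fin 2)) (G : SimpleGraph V) : Prop :=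
  ∃ w : List V, IsRepresentedBy L G w

/-- `L⁺ = L L*`. -/
def languagePlus (L : Language (Fin 2)) : Language (Fin 2) := L * L∗

/-- The language consisting of one single word. -/
def wordLanguage (w : List (Fin 2)) : Language (Fin 2) := {w}

/-- `(00)⁺ (11)* 0⁺` -/
def oddEvenPattern : Language (Fin 2) :=
  languagePlus (wordLanguage [0, 0]) * (wordLanguage [1, 1])∗ * languagePlus (wordLanguage [0])

/-- `(11)⁺ (00)* 1⁺` -/
def evenOddPattern : Language (Fin 2) :=
  languagePlus (wordLanguage [1, 1]) * (wordLanguage [0, 0])∗ * languagePlus (wordLanguage [1])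

/-- `⟨(00)⁺ 1* 0*⟩` -/
def evenEvenPattern : Language (Fin 2) :=
  symmClosure
    (languagePlus (wordLanguage [0, 0]) * (wordLanguage [1])∗ * (wordLanguage [0])∗)

/-- The language of all binary words in which each letter occurs between `2` and `2k+1` times and
that avoid the pattern belonging to the parities of these two numbers (there is no excluded
pattern if both numbers are odd). -/
def circleGonLanguage (k : ℕ) : Language (Fin 2) :=
  {w | (2 ≤ w.count 0 ∧ w.count 0 ≤ 2 * k + 1) ∧ (2 ≤ w.count 1 ∧ w.count 1 ≤ 2 * k + 1) ∧
    (Odd (w.count 0) ∧ Even (w.count 1) → w ∉ oddEvenPattern) ∧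
    (Even (w.count 0) ∧ Odd (w.count 1) → w ∉ evenOddPattern) ∧
    (Even (w.count 0) ∧ Even (w.count 1) → w ∉ evenEvenPattern)}

/-! ### Circle-`k`-gons and their intersection graphs -/

/-- The point of the unit circle at angle `θ`. -/
noncomputable def circlePoint (θ : ℝ) : ℂ := Complex.exp (θ * Complex.I)

/-- The closed half-plane to the left of the line through `p` and `q`, directed from `p` to `q`. -/
def leftSide (p q : ℂ) : Set ℂ :=
  {z | 0 ≤ (starRingEnd ℂ (q - p) * (z - p)).im}

/-- The boundary data of a region with `m ≥ 1` chord sides: counterclockwise around the unit circle,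
the arc sides `[arcStart i, arcEnd i]` (which may degenerate to a point where two chords meet)
alternate with the chord sides, the `i`-th chord joining the end of arc `i` to the start of
arc `i + 1` (cyclically). -/
structure CircleGon (m : ℕ) [NeZero m] where
  arcStart : Fin m → ℝ
  arcEnd : Fin m → ℝ
  start_le_end : ∀ i, arcStart i ≤ arcEnd i
  end_lt_start : ∀ i j, i < j → arcEnd i < arcStart j
  end_lt_turn : ∀ i j, arcEnd i < arcStart j + 2 * Real.pi
  chord_ne : ∀ i, circlePoint (arcEnd i) ≠ circlePoint (arcStart (i + 1))

/-- The region of the closed unit disc that lies between the chords. The part of the disc cut off by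
chord `i`, with the circle points strictly between arc `i` and arc `i + 1`, is to the right
of this chord. -/
def CircleGon.region {m : ℕ} [NeZero m] (P : CircleGon m) : Set ℂ :=
  {z | ‖z‖ ≤ 1 ∧
    ∀ i, z ∈ leftSide (circlePoint (P.arcEnd i)) (circlePoint (P.arcStart (i + 1)))}

/-- A circle-`k`-gon: a region between `k` or fewer chords. -/
def IsCircleGon (k : ℕ) (D : Set ℂ) : Prop :=
  ∃ (m : ℕ) (_ : NeZero m) (P : CircleGon m), m ≤ k ∧ D = P.region

/-- Circle-`k`-gon graphs: the intersection graphs of families of circle-`k`-gons. -/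
def IsCircleGonGraph {V : Type u} (k : ℕ) (G : SimpleGraph V) : Prop :=
  ∃ D : V → Set ℂ, (∀ v, IsCircleGon k (D v)) ∧
    ∀ a b : V, a ≠ b → (G.Adj a b ↔ (D a ∩ D b).Nonempty)

/-- Circle-`k`-gon graphs plus isolated vertices: `G` arises from the circle-`k`-gon graph `G[S]` by
adding isolated vertices. -/
def IsCircleGonGraphPlusIsolated {V : Type u} (k : ℕ) (G : SimpleGraph V) : Prop :=
  ∃ S : Set V, IsCircleGonGraph k (G.induce S) ∧ ∀ v, v ∉ S → ∀ x, ¬ G.Adj v x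

/-! ### Speed of graph classes -/

/-- The number of graphs with vertex set `{0, …, n-1}` in the class `C`. -/
noncomputable def graphClassSpeed (C : ∀ n : ℕ, SimpleGraph (Fin n) → Prop) (n : ℕ) : ℕ :=
  Set.ncard {G : SimpleGraph (Fin n) | C n G}

/-- Factorial speed: `n^(c₁ n) ≤ |Cⁿ| ≤ n^(c₂ n)` for some constants `c₁, c₂ > 0`. -/
def HasFactorialSpeed (C : ∀ n : ℕ, SimpleGraph (Fin n) → Prop) : Prop :=
  ∃ c₁ c₂ : ℝ, 0 < c₁ ∧ 0 < c₂ ∧ ∀ n : ℕ, 1 ≤ n →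
    (n : ℝ) ^ (c₁ * n) ≤ (graphClassSpeed C n : ℝ) ∧
    (graphClassSpeed C n : ℝ) ≤ (n : ℝ) ^ (c₂ * n)

/-! A circle-gon is encoded by its corners, read once around the circle from a base point that is
not a corner. If the base point lies on an arc, one extra letter is put in front of them; it stands
for the start of the interrupted arc. Thus even indices (from 0) always belong to starts of arcs and
odd indices to ends, and an `m`-gon yields `2m` or `2m + 1` letters. A vertex with fewer than 2 or
more than `2k + 1` letters is isolated because of the length bounds in the language.

Two regions are disjoint exactly when all arcs of one lie in a single gap of the other
(`PeriodicGon.not_inter_region_nonempty_iff`). This relation is symmetric, so the roles can be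
chosen such that, read from the base point, `D` comes after some arc of `C` has ended and before the
next one starts (`BasedGon.Follows`). In letters: the letters of `D` are even in number, since the
base point is not on an arc of `D`, and they form one block after an even positive number of letters
of `C`, since the last corner of `C` before them is an end of an arc. This is `BlockAfterEven`, and
`mem_circleGonLanguage_iff` shows that the excluded patterns are just its parity cases, in both
directions.

The bridge `blockAfterEven_iff_follows` serves both inclusions: positions in a word become angles,
and conversely the corners of given circle-gons are sorted into a word.

For the speed, disjoint unions of cliques are realised by disjoint circular segments and give the
lower bound; the upper bound counts words of length at most `n(2k + 1)`. -/

/-! ### The excluded patterns as a single condition -/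

/-- Every occurrence of `b` in `w` is preceded by exactly `x` letters `a`, where `y` of these have
been read before `w`. -/
def EachSeen {α : Type*} [DecidableEq α] (a b : α) (x : ℕ) : ℕ → List α → Prop
  | _, [] => True
  | y, c :: w => (c = b → y = x) ∧ EachSeen a b x (y + if c = a then 1 else 0) w

/-- The letters `b` of `w` are even in number and form one block, after an even and positive number
of letters `a`. -/
def BlockAfterEven {α : Type*} [DecidableEq α] (a b : α) (w : List α) : Prop :=
  Even (w.count b) ∧ ∃ x, Even x ∧ 2 ≤ x ∧ EachSeen a b x 0 w

theorem mem_kstar_wordLanguage {x w : List (Fin 2)} :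
    w ∈ (wordLanguage x)∗ ↔ ∃ n, w = (List.replicate n x).flatten := by
  rw [Language.mem_kstar]
  constructor
  · rintro ⟨L, rfl, hL⟩
    exact ⟨L.length, by rw [← List.eq_replicate_of_mem (a := x) (l := L) hL]⟩
  · rintro ⟨n, rfl⟩
    exact ⟨_, rfl, fun y hy => List.eq_of_mem_replicate hy⟩

theorem flatten_replicate_singleton (n : ℕ) (c : Fin 2) :
    (List.replicate n [c]).flatten = List.replicate n c := by
  induction n with
  | zero => rfl
  | succ n ih => simp [List.replicate_succ, ih]

theorem flatten_replicate_pair (n : ℕ) (c : Fin 2) :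
    (List.replicate n [c, c]).flatten = List.replicate (2 * n) c := by
  induction n with
  | zero => rfl
  | succ n ih => simp [List.replicate_succ, ih, Nat.mul_succ]

theorem mem_languagePlus_wordLanguage {x w : List (Fin 2)} :
    w ∈ languagePlus (wordLanguage x) ↔ ∃ n, 1 ≤ n ∧ w = (List.replicate n x).flatten := by
  rw [languagePlus, Language.mem_mul]
  constructor
  · rintro ⟨p, hp, q, hq, rfl⟩
    obtain ⟨n, rfl⟩ := mem_kstar_wordLanguage.1 hq
    obtain rfl : p = x := hp
    exact ⟨n + 1, by omega, by simp [List.replicate_succ]⟩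
  · rintro ⟨n, hn, rfl⟩
    obtain ⟨n, rfl⟩ := Nat.exists_eq_add_of_le' hn
    exact ⟨x, rfl, _, mem_kstar_wordLanguage.2 ⟨n, rfl⟩, by simp [List.replicate_succ]⟩

theorem mem_oddEvenPattern {w : List (Fin 2)} : w ∈ oddEvenPattern ↔
    ∃ a b c, 1 ≤ a ∧ 1 ≤ c ∧
      w = List.replicate (2 * a) 0 ++ (List.replicate (2 * b) 1 ++ List.replicate c 0) := by
  simp only [oddEvenPattern, Language.mem_mul, mem_languagePlus_wordLanguage,
    mem_kstar_wordLanguage, flatten_replicate_singleton, flatten_replicate_pair]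
  constructor
  · rintro ⟨_, ⟨_, ⟨a, ha, rfl⟩, _, ⟨b, rfl⟩, rfl⟩, _, ⟨c, hc, rfl⟩, rfl⟩
    exact ⟨a, b, c, ha, hc, by simp⟩
  · rintro ⟨a, b, c, ha, hc, rfl⟩
    exact ⟨_, ⟨_, ⟨a, ha, rfl⟩, _, ⟨b, rfl⟩, rfl⟩, _, ⟨c, hc, rfl⟩, by simp⟩

theorem mem_evenOddPattern {w : List (Fin 2)} : w ∈ evenOddPattern ↔
    ∃ a b c, 1 ≤ a ∧ 1 ≤ c ∧
      w = List.replicate (2 * a) 1 ++ (List.replicate (2 * b) 0 ++ List.replicate c 1) := by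
  simp only [evenOddPattern, Language.mem_mul, mem_languagePlus_wordLanguage,
    mem_kstar_wordLanguage, flatten_replicate_singleton, flatten_replicate_pair]
  constructor
  · rintro ⟨_, ⟨_, ⟨a, ha, rfl⟩, _, ⟨b, rfl⟩, rfl⟩, _, ⟨c, hc, rfl⟩, rfl⟩
    exact ⟨a, b, c, ha, hc, by simp⟩
  · rintro ⟨a, b, c, ha, hc, rfl⟩
    exact ⟨_, ⟨_, ⟨a, ha, rfl⟩, _, ⟨b, rfl⟩, rfl⟩, _, ⟨c, hc, rfl⟩, by simp⟩

theorem complementWord_complementWord (w : List (Fin 2)) :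
    complementWord (complementWord w) = w := by
  rw [complementWord, complementWord, List.map_map]
  refine (List.map_congr_left fun x _ => ?_).trans (List.map_id w)
  fin_cases x <;> rfl

theorem count_zero_complementWord (w : List (Fin 2)) :
    (complementWord w).count 0 = w.count 1 := by
  induction w with
  | nil => rfl
  | cons c w ih =>
    simp only [complementWord, List.map_cons] at ih ⊢
    fin_cases c <;> simp [ih]

theorem count_one_complementWord (w : List (Fin 2)) :
    (complementWord w).count 1 = w.count 0 := by
  rw [← count_zero_complementWord, complementWord_complementWord]

theorem mem_symmClosure {L : Language (Fin 2)} {w : List (Fin 2)} :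
    w ∈ symmClosure L ↔ w ∈ L ∨ complementWord w ∈ L := by
  constructor
  · rintro ⟨x, hx, rfl | rfl⟩
    · exact .inl hx
    · exact .inr (by rwa [complementWord_complementWord])
  · rintro (h | h)
    · exact ⟨w, h, .inl rfl⟩
    · exact ⟨_, h, .inr (complementWord_complementWord w).symm⟩

theorem mem_evenEvenPattern {w : List (Fin 2)} : w ∈ evenEvenPattern ↔
    (∃ a b c, 1 ≤ a ∧
      w = List.replicate (2 * a) 0 ++ (List.replicate b 1 ++ List.replicate c 0)) ∨
    ∃ a b c, 1 ≤ a ∧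
      complementWord w =
        List.replicate (2 * a) 0 ++ (List.replicate b 1 ++ List.replicate c 0) := by
  have key : ∀ w : List (Fin 2), w ∈ (languagePlus (wordLanguage [0, 0]) * (wordLanguage [1])∗ *
      (wordLanguage [0])∗ : Language (Fin 2)) ↔ ∃ a b c, 1 ≤ a ∧
      w = List.replicate (2 * a) 0 ++ (List.replicate b 1 ++ List.replicate c 0) := by
    intro w
    simp only [Language.mem_mul, mem_languagePlus_wordLanguage,
      mem_kstar_wordLanguage, flatten_replicate_singleton, flatten_replicate_pair]
    constructor
    · rintro ⟨_, ⟨_, ⟨a, ha, rfl⟩, _, ⟨b, rfl⟩, rfl⟩, _, ⟨c, rfl⟩, rfl⟩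
      exact ⟨a, b, c, ha, by simp⟩
    · rintro ⟨a, b, c, ha, rfl⟩
      exact ⟨_, ⟨_, ⟨a, ha, rfl⟩, _, ⟨b, rfl⟩, rfl⟩, _, ⟨c, rfl⟩, by simp⟩
  rw [evenEvenPattern, mem_symmClosure, key, key]

theorem eachSeen_of_not_mem {α : Type*} [DecidableEq α] {a b : α} {x y : ℕ} {w : List α}
    (h : b ∉ w) : EachSeen a b x y w := by
  induction w generalizing y with
  | nil => trivial
  | cons c w ih =>
    simp only [List.mem_cons, not_or] at h
    exact ⟨fun e => absurd e.symm h.1, ih h.2⟩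

theorem not_mem_of_eachSeen_of_lt {α : Type*} [DecidableEq α] {a b : α} {x y : ℕ} {w : List α}
    (h : EachSeen a b x y w) (hxy : x < y) : b ∉ w := by
  induction w generalizing y with
  | nil => simp
  | cons c w ih =>
    simp only [List.mem_cons, not_or]
    exact ⟨fun e => by have := h.1 e.symm; omega, ih h.2 (by omega)⟩

theorem eachSeen_le_count {α : Type*} [DecidableEq α] {a b : α} {x y : ℕ} {w : List α}
    (h : EachSeen a b x y w) (hb : b ∈ w) : x ≤ y + w.count a := by
  induction w generalizing y with
  | nil => simp at hb
  | cons c w ih =>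
    by_cases hc : c = b
    · have := h.1 hc; omega
    · have hb' : b ∈ w := by
        rcases List.mem_cons.1 hb with e | e
        · exact absurd e.symm hc
        · exact e
      have := ih h.2 hb'
      rw [List.count_cons]
      simp only [beq_iff_eq]
      omega

theorem eachSeen_block (x y b c : ℕ) (h : y ≤ x) :
    EachSeen (0 : Fin 2) 1 x y
      (List.replicate (x - y) 0 ++ (List.replicate b 1 ++ List.replicate c 0)) := by
  induction hd : x - y generalizing y with
  | zero =>
    obtain rfl : x = y := by omega
    simp only [List.replicate_zero, List.nil_append]
    induction b with
    | zero =>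
      exact eachSeen_of_not_mem (by simp [List.mem_replicate])
    | succ b ih => exact ⟨fun _ => rfl, by simpa [List.replicate_succ] using ih⟩
  | succ d ih =>
    rw [List.replicate_succ, List.cons_append]
    exact ⟨by simp, by simpa using ih (y + 1) (by omega) (by omega)⟩

/-- The bound `hx` guarantees that the prefix of `x - y` zeros really occurs; without a letter `1`
the predicate `EachSeen` alone says nothing. -/
theorem eq_block_of_eachSeen {x y : ℕ} {w : List (Fin 2)} (h : EachSeen (0 : Fin 2) 1 x y w)
    (hy : y ≤ x) (hx : x ≤ y + w.count 0) :
    w = List.replicate (x - y) 0 ++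
      (List.replicate (w.count 1) 1 ++ List.replicate (w.count 0 - (x - y)) 0) := by
  induction w generalizing y with
  | nil =>
    obtain rfl : x = y := by simp at hx; omega
    simp
  | cons c w ih =>
    obtain rfl | rfl : c = 0 ∨ c = 1 := by omega
    · have h2 := h.2
      simp only [if_true] at h2
      rcases hy.eq_or_lt with rfl | hlt
      -- One `0` too many has been read, so no `1` can follow and the rest consists of zeros.
      · have hn := not_mem_of_eachSeen_of_lt h2 (by omega)
        have h1 : w = List.replicate w.length 0 := List.eq_replicate_of_mem fun z hz => by
          have : z ≠ 1 := fun e => hn (e ▸ hz)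
          omega
        rw [h1]
        simp [List.count_replicate, List.replicate_succ]
      · have := ih h2 (by omega) (by simp at hx; omega)
        obtain ⟨d, rfl⟩ : ∃ d, x = y + 1 + d := ⟨x - (y + 1), by omega⟩
        rw [show y + 1 + d - y = d + 1 by omega, List.replicate_succ]
        rw [show y + 1 + d - (y + 1) = d by omega] at this
        simp only [List.cons_append, List.count_cons_self, Nat.add_sub_add_right]
        rw [List.count_cons_of_ne (by decide), ← this]
    · obtain rfl := h.1 rfl
      have := ih (by simpa using h.2) le_rfl (by omega)
      simp only [Nat.sub_self, List.replicate_zero, List.nil_append, Nat.sub_zero] at this ⊢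
      rw [List.count_cons_self, List.count_cons_of_ne (by decide), List.replicate_succ,
        List.cons_append, ← this]

theorem blockAfterEven_iff {w : List (Fin 2)} (h1 : Even (w.count 1)) (h : 1 ≤ w.count 1) :
    BlockAfterEven 0 1 w ↔ ∃ a b c, 1 ≤ a ∧
      w = List.replicate (2 * a) 0 ++ (List.replicate b 1 ++ List.replicate c 0) := by
  constructor
  · rintro ⟨-, x, hx, hx2, hs⟩
    obtain ⟨a, rfl⟩ := even_iff_exists_two_mul.1 hx
    have := eq_block_of_eachSeen hs (by omega)
      (eachSeen_le_count hs (List.count_pos_iff.1 h))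
    exact ⟨a, _, _, by omega, this⟩
  · rintro ⟨a, b, c, ha, rfl⟩
    exact ⟨h1, 2 * a, even_two_mul a, by omega, eachSeen_block (2 * a) 0 b c (by omega)⟩

/-- Parity makes up for the weaker shape: the block of ones is all of them, hence even, and the
final block of zeros is odd, hence nonempty. -/
theorem mem_oddEvenPattern_iff {w : List (Fin 2)} (h0 : Odd (w.count 0)) (h1 : Even (w.count 1)) :
    w ∈ oddEvenPattern ↔ ∃ a b c, 1 ≤ a ∧
      w = List.replicate (2 * a) 0 ++ (List.replicate b 1 ++ List.replicate c 0) := by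
  rw [mem_oddEvenPattern]
  constructor
  · rintro ⟨a, b, c, ha, -, rfl⟩
    exact ⟨a, _, c, ha, rfl⟩
  · rintro ⟨a, b, c, ha, rfl⟩
    simp [List.count_replicate] at h0 h1
    obtain ⟨d, rfl⟩ := even_iff_exists_two_mul.1 h1
    obtain ⟨e, he⟩ := h0
    exact ⟨a, d, c, ha, by omega, rfl⟩

theorem mem_evenOddPattern_iff_complementWord {w : List (Fin 2)} :
    w ∈ evenOddPattern ↔ complementWord w ∈ oddEvenPattern := by
  rw [mem_evenOddPattern, mem_oddEvenPattern]
  constructor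
  · rintro ⟨a, b, c, ha, hc, rfl⟩
    exact ⟨a, b, c, ha, hc, by simp [complementWord]⟩
  · rintro ⟨a, b, c, ha, hc, h⟩
    refine ⟨a, b, c, ha, hc, ?_⟩
    rw [← complementWord_complementWord w, h]
    simp [complementWord]

/-- `BlockAfterEven` contains the evenness of the block letter, so an odd count rules it out. What
remains is one pattern if one count is odd, none if both are, and a pattern and its complement if
both are even. -/
theorem mem_circleGonLanguage_iff {k : ℕ} {w : List (Fin 2)} : w ∈ circleGonLanguage k ↔
    (2 ≤ w.count 0 ∧ w.count 0 ≤ 2 * k + 1) ∧ (2 ≤ w.count 1 ∧ w.count 1 ≤ 2 * k + 1) ∧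
      ¬ BlockAfterEven 0 1 w ∧ ¬ BlockAfterEven 0 1 (complementWord w) := by
  refine and_congr_right fun h0 => and_congr_right fun h1 => ?_
  have c0 := count_zero_complementWord w
  have c1 := count_one_complementWord w
  rcases Nat.even_or_odd (w.count 0) with e0 | o0 <;>
    rcases Nat.even_or_odd (w.count 1) with e1 | o1
  · have n0 := Nat.not_odd_iff_even.2 e0
    have n1 := Nat.not_odd_iff_even.2 e1
    rw [mem_evenEvenPattern, ← blockAfterEven_iff e1 (by omega),
      ← blockAfterEven_iff (w := complementWord w) (by rwa [c1]) (by omega)]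
    tauto
  · have n0 := Nat.not_odd_iff_even.2 e0
    have n1 := Nat.not_even_iff_odd.2 o1
    rw [mem_evenOddPattern_iff_complementWord,
      mem_oddEvenPattern_iff (w := complementWord w) (by rwa [c0]) (by rwa [c1]),
      ← blockAfterEven_iff (w := complementWord w) (by rwa [c1]) (by omega)]
    have : ¬ BlockAfterEven 0 1 w := fun h => n1 h.1
    tauto
  · have n0 := Nat.not_even_iff_odd.2 o0
    have n1 := Nat.not_odd_iff_even.2 e1
    rw [mem_oddEvenPattern_iff o0 e1, ← blockAfterEven_iff e1 (by omega)]
    have : ¬ BlockAfterEven 0 1 (complementWord w) := fun h => n0 (c1 ▸ h.1)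
    tauto
  · have n0 := Nat.not_even_iff_odd.2 o0
    have n1 := Nat.not_even_iff_odd.2 o1
    have : ¬ BlockAfterEven 0 1 w := fun h => n1 h.1
    have : ¬ BlockAfterEven 0 1 (complementWord w) := fun h => n0 (c1 ▸ h.1)
    tauto

theorem complementWord_mem_circleGonLanguage {k : ℕ} {w : List (Fin 2)}
    (h : w ∈ circleGonLanguage k) : complementWord w ∈ circleGonLanguage k := by
  rw [mem_circleGonLanguage_iff] at h ⊢
  rw [count_zero_complementWord, count_one_complementWord, complementWord_complementWord]
  tauto

theorem isZeroOneSymmetric_circleGonLanguage (k : ℕ) :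
    IsZeroOneSymmetric (circleGonLanguage k) := by
  refine Set.ext fun w => ?_
  refine Iff.trans ?_ mem_symmClosure.symm
  refine ⟨Or.inl, ?_⟩
  rintro (h | h)
  · exact h
  · exact complementWord_complementWord w ▸ complementWord_mem_circleGonLanguage h

theorem finite_circleGonLanguage (k : ℕ) :
    Set.Finite {w : List (Fin 2) | w ∈ circleGonLanguage k} := by
  refine (List.finite_length_le (Fin 2) (4 * k + 2)).subset fun w hw => ?_
  obtain ⟨⟨-, h0⟩, ⟨-, h1⟩, -⟩ := hw
  have : ∀ w : List (Fin 2), w.length = w.count 0 + w.count 1 := by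
    intro w
    induction w with
    | nil => rfl
    | cons c w ih =>
      fin_cases c <;> simp [ih] <;> omega
  have := this w
  exact show w.length ≤ 4 * k + 2 by omega

/-! ### From binary words back to words over the vertices -/

section Projection

variable {V : Type*} [DecidableEq V] {a b : V}

theorem pairProjection_cons (c : V) (w : List V) : pairProjection a b (c :: w) =
    (if c = a then [0] else if c = b then [1] else []) ++ pairProjection a b w := by
  simp [pairProjection]

theorem count_zero_pairProjection (w : List V) :
    (pairProjection a b w).count 0 = w.count a := by
  induction w with
  | nil => rfl
  | cons c w ih =>
    rw [pairProjection_cons, List.count_append, ih, List.count_cons]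
    split_ifs <;> simp_all
    omega

theorem complementWord_pairProjection (hab : a ≠ b) (w : List V) :
    complementWord (pairProjection a b w) = pairProjection b a w := by
  induction w with
  | nil => rfl
  | cons c w ih =>
    rw [pairProjection_cons, pairProjection_cons, ← ih]
    split_ifs <;> simp_all [complementWord]

theorem count_one_pairProjection (hab : a ≠ b) (w : List V) :
    (pairProjection a b w).count 1 = w.count b := by
  rw [← count_zero_complementWord, complementWord_pairProjection hab, count_zero_pairProjection]

theorem eachSeen_pairProjection (hab : a ≠ b) (x y : ℕ) (w : List V) :
    EachSeen 0 1 x y (pairProjection a b w) ↔ EachSeen a b x y w := by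
  induction w generalizing y with
  | nil => rfl
  | cons c w ih =>
    rw [pairProjection_cons]
    split_ifs with h1 h2
    · simp [EachSeen, ih, h1, hab]
    · simp [EachSeen, ih, h2, hab.symm]
    · simp [EachSeen, ih, h1, h2]

theorem blockAfterEven_pairProjection (hab : a ≠ b) (w : List V) :
    BlockAfterEven 0 1 (pairProjection a b w) ↔ BlockAfterEven a b w := by
  simp only [BlockAfterEven, count_one_pairProjection hab, eachSeen_pairProjection hab]

theorem pairProjection_mem_circleGonLanguage (hab : a ≠ b) {k : ℕ} {w : List V} :
    pairProjection a b w ∈ circleGonLanguage k ↔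
      (2 ≤ w.count a ∧ w.count a ≤ 2 * k + 1) ∧ (2 ≤ w.count b ∧ w.count b ≤ 2 * k + 1) ∧
        ¬ BlockAfterEven a b w ∧ ¬ BlockAfterEven b a w := by
  rw [mem_circleGonLanguage_iff, complementWord_pairProjection hab,
    blockAfterEven_pairProjection hab, blockAfterEven_pairProjection hab.symm,
    count_zero_pairProjection, count_one_pairProjection hab]

/-- Counting in a word that lists the labels of an increasing sequence. -/
theorem eachSeen_map_iff {K : Type*} [LinearOrder K] (label : K → V) (x y : ℕ) {l : List K}
    (hl : l.SortedLT) : EachSeen a b x y (l.map label) ↔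
      ∀ z ∈ l, label z = b → y + l.countP (fun t => label t = a ∧ t < z) = x := by
  induction l generalizing y with
  | nil => simp [EachSeen]
  | cons c l ih =>
    have hl' := List.pairwise_cons.1 hl.pairwise
    rw [List.map_cons, EachSeen, ih _ hl'.2.sortedLT, List.forall_mem_cons]
    refine and_congr ?_ ?_
    · rw [List.countP_eq_zero.2]
      · simp
      · intro t ht
        rcases List.mem_cons.1 ht with rfl | ht
        · simp
        · simp [(hl'.1 t ht).le]
    · refine forall₂_congr fun z hz => ?_
      rw [List.countP_cons]
      simp only [hl'.1 z hz, and_true, decide_eq_true_eq]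
      rw [add_assoc, add_comm (ite _ _ _)]

end Projection

/-! ### Chords of the unit circle -/

open Real in
theorem circlePoint_add_two_pi_mul (θ : ℝ) (n : ℤ) :
    circlePoint (θ + 2 * π * n) = circlePoint θ := by
  rw [circlePoint, circlePoint, Complex.exp_eq_exp_iff_exists_int]
  exact ⟨n, by push_cast; ring⟩

theorem circlePoint_re (θ : ℝ) : (circlePoint θ).re = Real.cos θ := by
  rw [circlePoint, Complex.exp_ofReal_mul_I_re]

theorem circlePoint_im (θ : ℝ) : (circlePoint θ).im = Real.sin θ := by
  rw [circlePoint, Complex.exp_ofReal_mul_I_im]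

theorem norm_circlePoint (θ : ℝ) : ‖circlePoint θ‖ = 1 :=
  Complex.norm_exp_ofReal_mul_I θ

/-- Twice the signed area of the triangle `p`, `q`, `z`. -/
noncomputable def chordSide (p q z : ℂ) : ℝ := (starRingEnd ℂ (q - p) * (z - p)).im

theorem mem_leftSide {p q z : ℂ} : z ∈ leftSide p q ↔ 0 ≤ chordSide p q z := Iff.rfl

theorem chordSide_eq (p q z : ℂ) : chordSide p q z =
    (q.re - p.re) * (z.im - p.im) - (q.im - p.im) * (z.re - p.re) := by
  simp [chordSide, Complex.mul_im]
  ring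

theorem chordSide_combo {p q x y : ℂ} {a b : ℝ} (h : a + b = 1) :
    chordSide p q (a • x + b • y) = a * chordSide p q x + b * chordSide p q y := by
  obtain rfl : a = 1 - b := by linarith
  simp only [chordSide_eq, Complex.add_re, Complex.add_im, Complex.real_smul,
    Complex.re_ofReal_mul, Complex.im_ofReal_mul]
  ring

/-- With this factorisation, the side of a chord on which a circle point lies is read off from the
signs of three sines of half differences. -/
theorem chordSide_circlePoint (a b θ : ℝ) :
    chordSide (circlePoint a) (circlePoint b) (circlePoint θ) =
      4 * Real.sin ((b - a) / 2) * Real.sin ((θ - b) / 2) * Real.sin ((θ - a) / 2) := by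
  rw [chordSide_eq]
  simp only [circlePoint_re, circlePoint_im, Real.cos_sub_cos, Real.sin_sub_sin]
  rw [show (θ - b) / 2 = (θ + a) / 2 - (b + a) / 2 by ring, Real.sin_sub]
  ring

section Sides

variable {a b θ : ℝ}

theorem chordSide_circlePoint_nonneg (hab : a < b) (hb : b < a + 2 * Real.pi) (h1 : b ≤ θ)
    (h2 : θ ≤ a + 2 * Real.pi) :
    0 ≤ chordSide (circlePoint a) (circlePoint b) (circlePoint θ) := by
  rw [chordSide_circlePoint]
  have s1 := Real.sin_nonneg_of_nonneg_of_le_pi (x := (b - a) / 2) (by linarith) (by linarith)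
  have s2 := Real.sin_nonneg_of_nonneg_of_le_pi (x := (θ - b) / 2) (by linarith) (by linarith)
  have s3 := Real.sin_nonneg_of_nonneg_of_le_pi (x := (θ - a) / 2) (by linarith) (by linarith)
  positivity

theorem chordSide_circlePoint_neg (hb : b < a + 2 * Real.pi) (h1 : a < θ) (h2 : θ < b) :
    chordSide (circlePoint a) (circlePoint b) (circlePoint θ) < 0 := by
  rw [chordSide_circlePoint]
  have s1 := Real.sin_pos_of_pos_of_lt_pi (x := (b - a) / 2) (by linarith) (by linarith)
  have s2 := Real.sin_neg_of_neg_of_neg_pi_lt (x := (θ - b) / 2) (by linarith) (by linarith)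
  have s3 := Real.sin_pos_of_pos_of_lt_pi (x := (θ - a) / 2) (by linarith) (by linarith)
  exact mul_neg_of_neg_of_pos (mul_neg_of_pos_of_neg (by positivity) s2) s3

theorem circlePoint_ne (hab : a < b) (hb : b < a + 2 * Real.pi) :
    circlePoint a ≠ circlePoint b := by
  intro h
  have := chordSide_circlePoint_neg (a := a) (b := b) (θ := (a + b) / 2) hb (by linarith)
    (by linarith)
  rw [h] at this
  simp [chordSide] at this

end Sides

theorem mem_segment_of_chordSide_eq_zero {p q z : ℂ} (hp : ‖p‖ = 1) (hq : ‖q‖ = 1) (hpq : p ≠ q)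
    (hz : ‖z‖ ≤ 1) (h : chordSide p q z = 0) : z ∈ segment ℝ p q := by
  rw [chordSide_eq] at h
  have np : p.re * p.re + p.im * p.im = 1 := by
    rw [← Complex.normSq_apply, Complex.normSq_eq_norm_sq, hp, one_pow]
  have nq : q.re * q.re + q.im * q.im = 1 := by
    rw [← Complex.normSq_apply, Complex.normSq_eq_norm_sq, hq, one_pow]
  have nz : z.re * z.re + z.im * z.im ≤ 1 := by
    rw [← Complex.normSq_apply, Complex.normSq_eq_norm_sq]
    exact pow_le_one₀ (norm_nonneg z) hz
  set u := q.re - p.re with hu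
  set v := q.im - p.im with hv
  have hd : 0 < u * u + v * v := by
    by_contra hn
    refine hpq (Complex.ext ?_ ?_) <;> nlinarith [sq_nonneg u, sq_nonneg v]
  set t := (u * (z.re - p.re) + v * (z.im - p.im)) / (u * u + v * v) with ht
  have htd : t * (u * u + v * v) = u * (z.re - p.re) + v * (z.im - p.im) :=
    div_mul_cancel₀ _ hd.ne'
  have e1 : z.re = p.re + t * u := mul_right_cancel₀ hd.ne' (by
    linear_combination (-v) * h - u * htd)
  have e2 : z.im = p.im + t * v := mul_right_cancel₀ hd.ne' (by
    linear_combination u * h - v * htd)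
  have hdot : 2 * (p.re * u + p.im * v) = -(u * u + v * v) := by
    rw [hu, hv]; linear_combination nq - np
  -- With `z = p + t (q - p)` and both endpoints on the unit circle, `‖z‖ ≤ 1` turns into `t² ≤ t`.
  have key : (t * t - t) * (u * u + v * v) ≤ 0 := by
    rw [e1, e2] at nz
    linear_combination nz - np - t * hdot
  have ht2 : t * t - t ≤ 0 := by
    by_contra hn
    exact absurd key (not_le.2 (mul_pos (not_le.1 hn) hd))
  have t0 : 0 ≤ t := by nlinarith
  have t1 : t ≤ 1 := by nlinarith
  refine ⟨1 - t, t, by linarith, t0, by ring, Complex.ext ?_ ?_⟩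
  · simp only [Complex.add_re, Complex.real_smul, Complex.re_ofReal_mul]
    rw [e1, hu]; ring
  · simp only [Complex.add_im, Complex.real_smul, Complex.im_ofReal_mul]
    rw [e2, hv]; ring

/-- A circular segment is covered by the chords between points of its arc. -/
theorem exists_mem_segment_of_mem_leftSide {s e : ℝ} {z : ℂ} (hse : s < e)
    (he : e < s + 2 * Real.pi) (hz : ‖z‖ ≤ 1)
    (h : z ∈ leftSide (circlePoint e) (circlePoint s)) :
    ∃ θ ∈ Set.Icc s e, ∃ φ ∈ Set.Icc s e, z ∈ segment ℝ (circlePoint θ) (circlePoint φ) := by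
  -- Rotation by the middle angle `c` makes the bounding chord vertical; `x`, `y` are the rotated
  -- coordinates of `z`, and the vertical chord through `z` has its endpoints at the angles `c ±
  -- arccos x`.
  set c := (s + e) / 2 with hc
  set r := (e - s) / 2 with hr
  have hsin : 0 < Real.sin r := Real.sin_pos_of_pos_of_lt_pi (by linarith) (by linarith)
  set x := z.re * Real.cos c + z.im * Real.sin c with hx
  set y := z.im * Real.cos c - z.re * Real.sin c with hy
  have hcc := Real.sin_sq_add_cos_sq c
  have hxr : Real.cos r ≤ x := by
    rw [mem_leftSide, chordSide_eq] at h
    simp only [circlePoint_re, circlePoint_im] at h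
    rw [show s = c - r by rw [hc, hr]; ring, show e = c + r by rw [hc, hr]; ring] at h
    simp only [Real.cos_add, Real.sin_add, Real.cos_sub, Real.sin_sub] at h
    have h' : 0 ≤ 2 * Real.sin r * (x - Real.cos r) := by
      rw [hx]
      refine h.trans_eq ?_
      linear_combination (-2 * Real.sin r * Real.cos r) * hcc
    have := nonneg_of_mul_nonneg_right h' (by positivity)
    linarith
  have hxy : x ^ 2 + y ^ 2 ≤ 1 := by
    have nz : z.re * z.re + z.im * z.im ≤ 1 := by
      rw [← Complex.normSq_apply, Complex.normSq_eq_norm_sq]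
      exact pow_le_one₀ (norm_nonneg z) hz
    refine le_trans (le_of_eq ?_) nz
    rw [hx, hy]
    linear_combination (z.re ^ 2 + z.im ^ 2) * hcc
  have hx1 : x ≤ 1 := by nlinarith [sq_nonneg y]
  have hx0 : -1 ≤ x := (Real.neg_one_le_cos r).trans hxr
  set φ := Real.arccos x with hφ
  have hφr : φ ≤ r := by
    rw [← Real.arccos_cos (x := r) (by linarith) (by linarith)]
    exact Real.arccos_le_arccos hxr
  have hφ0 : 0 ≤ φ := Real.arccos_nonneg x
  have hcosφ : Real.cos φ = x := Real.cos_arccos hx0 hx1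
  have hsinφ : 0 ≤ Real.sin φ := Real.sin_nonneg_of_nonneg_of_le_pi hφ0 (Real.arccos_le_pi x)
  have hyφ : |y| ≤ Real.sin φ := by
    refine abs_le_of_sq_le_sq ?_ hsinφ
    have := Real.sin_sq_add_cos_sq φ
    rw [hcosφ] at this
    linarith
  obtain ⟨t, ht, hty⟩ : ∃ t ∈ Set.Icc (0 : ℝ) 1, y = (2 * t - 1) * Real.sin φ := by
    rcases hsinφ.eq_or_lt with h0 | h0
    · refine ⟨0, by simp, ?_⟩
      rw [← h0] at hyφ ⊢
      simpa using hyφ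
    · have := abs_le.1 hyφ
      refine ⟨(y / Real.sin φ + 1) / 2, ⟨?_, ?_⟩, by field_simp; ring⟩
      · have : -1 ≤ y / Real.sin φ := by rw [le_div_iff₀ h0]; linarith
        linarith
      · have : y / Real.sin φ ≤ 1 := by rw [div_le_iff₀ h0]; linarith
        linarith
  have hzre : z.re = x * Real.cos c - y * Real.sin c := by
    rw [hx, hy]; linear_combination (-z.re) * hcc
  have hzim : z.im = x * Real.sin c + y * Real.cos c := by
    rw [hx, hy]; linear_combination (-z.im) * hcc
  refine ⟨c - φ, ⟨by linarith, by linarith⟩, c + φ, ⟨by linarith, by linarith⟩,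
    1 - t, t, by linarith [ht.2], ht.1, by ring, Complex.ext ?_ ?_⟩
  · simp only [Complex.add_re, Complex.real_smul, Complex.re_ofReal_mul, circlePoint_re,
      Real.cos_add, Real.cos_sub]
    rw [hzre, hty, hcosφ]; ring
  · simp only [Complex.add_im, Complex.real_smul, Complex.im_ofReal_mul, circlePoint_im,
      Real.sin_add, Real.sin_sub]
    rw [hzim, hty, hcosφ]; ring

/-! ### Unrolled circle-gons and when they are disjoint -/

/-- A circle-`m`-gon, unrolled: on the universal cover of the circle the arcs are the intervals
from `pt (2 * i)` to `pt (2 * i + 1)`, and `m` of them make a full turn. -/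
structure PeriodicGon (m : ℕ) where
  pt : ℤ → ℝ
  pt_add_turn : ∀ j, pt (j + 2 * m) = pt j + 2 * Real.pi
  start_le_end : ∀ i, pt (2 * i) ≤ pt (2 * i + 1)
  end_lt_start : ∀ i, pt (2 * i + 1) < pt (2 * i + 2)
  start_lt_turn : ∀ i, pt (2 * i + 2) < pt (2 * i + 1) + 2 * Real.pi

namespace PeriodicGon

variable {m n : ℕ} (P : PeriodicGon m) (Q : PeriodicGon n)

def region : Set ℂ :=
  {z | ‖z‖ ≤ 1 ∧
    ∀ i : ℤ, z ∈ leftSide (circlePoint (P.pt (2 * i + 1))) (circlePoint (P.pt (2 * i + 2)))}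

theorem monotone_pt : Monotone P.pt := by
  refine monotone_int_of_le_succ fun j => ?_
  obtain ⟨i, rfl | rfl⟩ := Int.even_or_odd' j
  · exact P.start_le_end i
  · rw [add_assoc]
    exact (P.end_lt_start i).le

theorem pt_lt_of_odd_of_even {i j : ℤ} (h : 2 * i + 1 < 2 * j) :
    P.pt (2 * i + 1) < P.pt (2 * j) :=
  (P.end_lt_start i).trans_le (P.monotone_pt (by omega))

theorem pt_add_turns (j t : ℤ) : P.pt (j + 2 * m * t) = P.pt j + 2 * Real.pi * t := by
  induction t with
  | zero => simp
  | succ t ih =>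
    have := P.pt_add_turn (j + 2 * m * t)
    rw [ih] at this
    rw [show j + 2 * m * ((t : ℤ) + 1) = j + 2 * m * t + 2 * m by ring, this]
    push_cast; ring
  | pred t ih =>
    have := P.pt_add_turn (j + 2 * m * (-(t : ℤ) - 1))
    rw [show j + 2 * m * (-(t : ℤ) - 1) + 2 * m = j + 2 * m * (-(t : ℤ)) by ring, ih] at this
    push_cast at this ⊢
    linarith

theorem pos {m : ℕ} (P : PeriodicGon m) : 0 < m := by
  rcases Nat.eq_zero_or_pos m with rfl | h
  · have := P.pt_add_turn 0
    have := Real.pi_pos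
    simp at *
  · exact h

theorem exists_pt_le_lt (x : ℝ) : ∃ j, P.pt j ≤ x ∧ x < P.pt (j + 1) := by
  have hπ := Real.pi_pos
  have hm : (1 : ℤ) ≤ m := by exact_mod_cast P.pos
  obtain ⟨t, ht⟩ := exists_int_lt ((x - P.pt 0) / (2 * Real.pi))
  obtain ⟨t', ht'⟩ := exists_int_gt ((x - P.pt 0) / (2 * Real.pi))
  rw [lt_div_iff₀ (by positivity)] at ht
  rw [div_lt_iff₀ (by positivity)] at ht'
  have h1 := P.pt_add_turns 0 t
  have h2 := P.pt_add_turns 0 t'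
  obtain ⟨j, hj, hmax⟩ := Int.exists_greatest_of_bdd (P := fun j => P.pt j ≤ x)
    ⟨0 + 2 * m * t', fun z hz => by
      by_contra hn
      have := P.monotone_pt (not_le.1 hn).le
      linarith⟩ ⟨0 + 2 * m * t, by linarith⟩
  exact ⟨j, hj, not_le.1 fun h => by have := hmax _ h; omega⟩

/-- Each point lies on an arc or in a gap. -/
theorem exists_arc_or_gap (x : ℝ) : (∃ i, P.pt (2 * i) ≤ x ∧ x ≤ P.pt (2 * i + 1)) ∨
    ∃ i, P.pt (2 * i + 1) < x ∧ x < P.pt (2 * i + 2) := by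
  obtain ⟨j, hj, hj'⟩ := P.exists_pt_le_lt x
  obtain ⟨i, rfl | rfl⟩ := Int.even_or_odd' j
  · exact .inl ⟨i, hj, hj'.le⟩
  · rw [add_assoc] at hj'
    rcases hj.eq_or_lt with h | h
    · exact .inl ⟨i, by rw [← h]; exact P.start_le_end i, h.ge⟩
    · exact .inr ⟨i, h, hj'⟩

variable {P Q}

theorem circlePoint_mem_region {i : ℤ} {θ : ℝ} (h1 : P.pt (2 * i) ≤ θ)
    (h2 : θ ≤ P.pt (2 * i + 1)) : circlePoint θ ∈ P.region := by
  refine ⟨(norm_circlePoint θ).le, fun l => ?_⟩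
  have hm : (0 : ℤ) < m := by exact_mod_cast P.pos
  -- Turning back `t` times moves arc `i` to one of the arcs `l + 1, …, l + m`, which lie between
  -- gap `l` and its next copy.
  set t := (i - l - 1) / (m : ℤ) with ht
  have ht1 := Int.emod_add_mul_ediv (i - l - 1) m
  have ht2 := Int.emod_nonneg (i - l - 1) hm.ne'
  have ht3 := Int.emod_lt_of_pos (i - l - 1) hm
  rw [← ht] at ht1
  have hmt : 2 * (m : ℤ) * (-t) = -2 * (m * t) := by ring
  have e1 := P.pt_add_turns (2 * i) (-t)
  have e2 := P.pt_add_turns (2 * i + 1) (-t)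
  have e3 := P.pt_add_turn (2 * l + 1)
  have m1 : P.pt (2 * l + 2) ≤ P.pt (2 * i + 2 * m * (-t)) := P.monotone_pt (by omega)
  have m2 : P.pt (2 * i + 1 + 2 * m * (-t)) ≤ P.pt (2 * l + 1 + 2 * m) := P.monotone_pt (by omega)
  rw [mem_leftSide, ← circlePoint_add_two_pi_mul θ (-t)]
  exact chordSide_circlePoint_nonneg (P.end_lt_start l) (P.start_lt_turn l) (by linarith)
    (by linarith)

theorem combo_mem_region {x y : ℂ} (hx : x ∈ P.region) (hy : y ∈ P.region) {a b : ℝ} (ha : 0 ≤ a)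
    (hb : 0 ≤ b) (hab : a + b = 1) : a • x + b • y ∈ P.region := by
  refine ⟨?_, fun i => ?_⟩
  · have := (convex_closedBall (0 : ℂ) 1) (mem_closedBall_zero_iff.2 hx.1)
      (mem_closedBall_zero_iff.2 hy.1) ha hb hab
    exact mem_closedBall_zero_iff.1 this
  · rw [mem_leftSide, chordSide_combo hab]
    have h1 := mem_leftSide.1 (hx.2 i)
    have h2 := mem_leftSide.1 (hy.2 i)
    positivity

/-- Points of a region on both sides of a chord of another one make the regions meet. -/
theorem inter_region_nonempty_of_chordSide {x y : ℂ} (hx : x ∈ Q.region) (hy : y ∈ Q.region) (i : ℤ)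
    (hxi : chordSide (circlePoint (P.pt (2 * i + 1))) (circlePoint (P.pt (2 * i + 2))) x ≤ 0)
    (hyi : 0 ≤ chordSide (circlePoint (P.pt (2 * i + 1))) (circlePoint (P.pt (2 * i + 2))) y) :
    (P.region ∩ Q.region).Nonempty := by
  set p := circlePoint (P.pt (2 * i + 1))
  set q := circlePoint (P.pt (2 * i + 2))
  obtain ⟨a, b, ha, hb, hab, h⟩ : ∃ a b : ℝ, 0 ≤ a ∧ 0 ≤ b ∧ a + b = 1 ∧
      a * chordSide p q x + b * chordSide p q y = 0 := by
    rcases hxi.eq_or_lt with h0 | h0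
    · exact ⟨1, 0, by simp, by simp, by simp, by simp [h0]⟩
    · have hd : 0 < chordSide p q y - chordSide p q x := by linarith
      refine ⟨chordSide p q y / (chordSide p q y - chordSide p q x),
        -chordSide p q x / (chordSide p q y - chordSide p q x),
        div_nonneg hyi hd.le, div_nonneg (by linarith) hd.le, ?_, ?_⟩
      · field_simp; ring
      · field_simp; ring
  have hz := combo_mem_region hx hy ha hb hab
  refine ⟨_, ?_, hz⟩
  obtain ⟨a', b', ha', hb', hab', h'⟩ := mem_segment_of_chordSide_eq_zero (norm_circlePoint _)
    (norm_circlePoint _) (circlePoint_ne (P.end_lt_start i) (P.start_lt_turn i)) hz.1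
    ((chordSide_combo hab).trans h)
  rw [← h']
  refine combo_mem_region (circlePoint_mem_region (P.start_le_end i) le_rfl)
    (circlePoint_mem_region (i := i + 1) ?_ ?_) ha' hb' hab'
  · rw [mul_add, mul_one]
  · exact P.monotone_pt (by omega)

/-- The chord of `Q` that closes its run of arcs confines `Q` to a circular segment. This segment is
covered by chords between points of the gap, all strictly on the outer side of the chord of `P`. -/
theorem inter_region_eq_empty_of_gap {i j : ℤ} (h1 : P.pt (2 * i + 1) < Q.pt (2 * j))
    (h2 : Q.pt (2 * j + 2 * n - 1) < P.pt (2 * i + 2)) :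
    ¬ (P.region ∩ Q.region).Nonempty := by
  rintro ⟨z, hzP, hzQ⟩
  have g1 := Q.end_lt_start (j + n - 1)
  have g2 := Q.start_lt_turn (j + n - 1)
  have hz := hzQ.2 (j + n - 1)
  have e := Q.pt_add_turn (2 * j)
  have a1 : 2 * (j + (n : ℤ) - 1) + 1 = 2 * j + 2 * n - 1 := by ring
  have a2 : 2 * (j + (n : ℤ) - 1) + 2 = 2 * j + 2 * n := by ring
  rw [a1, a2, e] at g1 g2 hz
  have hc := circlePoint_add_two_pi_mul (Q.pt (2 * j)) 1
  rw [Int.cast_one, mul_one] at hc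
  rw [hc] at hz
  obtain ⟨θ, hθ, φ, hφ, a, b, ha, hb, hab, rfl⟩ :=
    exists_mem_segment_of_mem_leftSide (by linarith) g1 hzQ.1 hz
  have h := mem_leftSide.1 (hzP.2 i)
  rw [chordSide_combo hab] at h
  have n1 := chordSide_circlePoint_neg (P.start_lt_turn i) (h1.trans_le hθ.1) (hθ.2.trans_lt h2)
  have n2 := chordSide_circlePoint_neg (P.start_lt_turn i) (h1.trans_le hφ.1) (hφ.2.trans_lt h2)
  rcases ha.eq_or_lt with rfl | ha
  · obtain rfl : b = 1 := by linarith
    linarith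
  · have := mul_neg_of_pos_of_neg ha n1
    have := mul_nonpos_of_nonneg_of_nonpos hb n2.le
    linarith

/-- The regions are disjoint if and only if the arcs of one lie in a gap between arcs of the
other. -/
theorem not_inter_region_nonempty_iff : ¬ (P.region ∩ Q.region).Nonempty ↔
    ∃ i j : ℤ, P.pt (2 * i + 1) < Q.pt (2 * j) ∧ Q.pt (2 * j + 2 * n - 1) < P.pt (2 * i + 2) := by
  refine ⟨fun h => ?_, fun ⟨i, j, h1, h2⟩ => inter_region_eq_empty_of_gap h1 h2⟩
  have hQ0 : circlePoint (Q.pt (2 * 0)) ∈ Q.region :=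
    circlePoint_mem_region le_rfl (Q.start_le_end 0)
  obtain ⟨i, hi, hi'⟩ | ⟨i, hi, hi'⟩ := P.exists_arc_or_gap (Q.pt (2 * 0))
  · exact absurd ⟨_, circlePoint_mem_region hi hi', hQ0⟩ h
  have hx := (chordSide_circlePoint_neg (P.start_lt_turn i) hi hi').le
  -- A point of an arc of `Q` outside gap `i` would lie on the other side of the chord from `Q.pt
  -- 0`, and by convexity `Q` would meet that chord.
  have hno : ∀ l θ, Q.pt (2 * l) ≤ θ → θ ≤ Q.pt (2 * l + 1) → P.pt (2 * i + 2) ≤ θ →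
      θ ≤ P.pt (2 * i + 1) + 2 * Real.pi → False := fun l θ h1 h2 h3 h4 =>
    h (inter_region_nonempty_of_chordSide hQ0 (circlePoint_mem_region h1 h2) i hx
      (chordSide_circlePoint_nonneg (P.end_lt_start i) (P.start_lt_turn i) h3 h4))
  obtain ⟨l, hl, hl'⟩ | ⟨l, hl, hl'⟩ := Q.exists_arc_or_gap (P.pt (2 * i + 2))
  · exact (hno l _ hl hl' le_rfl (P.start_lt_turn i).le).elim
  have e := Q.pt_add_turn (2 * (l + 1 - n))
  -- The right end of gap `i` falls in gap `l` of `Q`, so arc `l` is the last of the `n` consecutive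
  -- arcs in gap `i`, and the first one has index `l + 1 - n`.
  rw [show 2 * (l + 1 - (n : ℤ)) + 2 * n = 2 * l + 2 by ring] at e
  refine ⟨i, l + 1 - n, ?_, ?_⟩
  · by_contra hn
    refine hno (l + 1) (Q.pt (2 * l + 2)) ?_ (Q.monotone_pt (by omega)) hl'.le (by linarith)
    rw [mul_add, mul_one]
  · rwa [show 2 * (l + 1 - (n : ℤ)) + 2 * n - 1 = 2 * l + 1 by ring]

end PeriodicGon

/-! ### Rolling up and unrolling -/

namespace PeriodicGon

variable {m n : ℕ}

/-- The same circle-gon, with its arcs renumbered. -/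
def shift (P : PeriodicGon m) (t : ℤ) : PeriodicGon m where
  pt j := P.pt (j + 2 * t)
  pt_add_turn j := by rw [← P.pt_add_turn]; ring_nf
  start_le_end i := by
    have := P.start_le_end (i + t)
    rwa [mul_add, add_right_comm] at this
  end_lt_start i := by
    have := P.end_lt_start (i + t)
    rwa [mul_add, add_right_comm, add_right_comm _ _ 2] at this
  start_lt_turn i := by
    have := P.start_lt_turn (i + t)
    rwa [mul_add, add_right_comm, add_right_comm _ _ 1] at this

theorem region_shift (P : PeriodicGon m) (t : ℤ) : (P.shift t).region = P.region := by
  ext z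
  refine and_congr_right fun _ => ⟨fun h i => ?_, fun h i => ?_⟩
  · have := h (i - t)
    simp only [shift] at this
    rwa [show 2 * (i - t) + 1 + 2 * t = 2 * i + 1 by ring,
      show 2 * (i - t) + 2 + 2 * t = 2 * i + 2 by ring] at this
  · have := h (i + t)
    simp only [shift]
    rwa [show 2 * (i + t) + 1 = 2 * i + 1 + 2 * t by ring,
      show 2 * (i + t) + 2 = 2 * i + 2 + 2 * t by ring] at this

/-- Rolling up a periodic gon. -/
def toCircleGon [NeZero m] (P : PeriodicGon m) : CircleGon m where
  arcStart i := P.pt (2 * (i : ℕ))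
  arcEnd i := P.pt (2 * (i : ℕ) + 1)
  start_le_end i := P.start_le_end _
  end_lt_start i j h := P.pt_lt_of_odd_of_even (by have : (i : ℕ) < j := h; omega)
  end_lt_turn i j := by
    rw [← P.pt_add_turn, ← mul_add]
    exact P.pt_lt_of_odd_of_even (by omega)
  chord_ne i := by
    have h := circlePoint_ne (P.end_lt_start (i : ℕ)) (P.start_lt_turn (i : ℕ))
    convert h using 1
    have hm : (i : ℕ) < m := i.2
    rcases Nat.lt_or_ge ((i : ℕ) + 1) m with hi | hi
    · rw [Fin.val_add_one_of_lt' hi]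
      push_cast; ring_nf
    · have hi' : (i : ℕ) + 1 = m := by omega
      have h0 : ((i + 1 : Fin m) : ℕ) = 0 := by
        rw [Fin.val_add, Fin.val_one', Nat.add_mod_mod, hi', Nat.mod_self]
      rw [h0, ← circlePoint_add_two_pi_mul _ 1, show (2 * ((i : ℕ) : ℤ) + 2) = 0 + 2 * m by omega,
        P.pt_add_turn]
      simp

theorem circlePoint_pt_emod (P : PeriodicGon m) (i c : ℤ) :
    circlePoint (P.pt (2 * (i % m) + c)) = circlePoint (P.pt (2 * i + c)) := by
  rw [← circlePoint_add_two_pi_mul (P.pt (2 * (i % m) + c)) (i / m), ← P.pt_add_turns]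
  congr 2
  have := Int.emod_add_mul_ediv i m
  linear_combination 2 * this

theorem arcStart_toCircleGon_add_one [NeZero m] (P : PeriodicGon m) (i : Fin m) :
    circlePoint (P.toCircleGon.arcStart (i + 1)) = circlePoint (P.pt (2 * (i : ℕ) + 2)) := by
  have := P.circlePoint_pt_emod ((i : ℕ) + 1) 0
  rw [add_zero, add_zero, mul_add, mul_one] at this
  rw [← this, toCircleGon]
  simp only [Fin.val_add, Fin.val_one', Nat.add_mod_mod]
  push_cast
  rfl

theorem region_toCircleGon [NeZero m] (P : PeriodicGon m) : P.toCircleGon.region = P.region := by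
  ext z
  refine and_congr_right fun _ => ⟨fun h i => ?_, fun h i => ?_⟩
  · have hm : (0 : ℤ) < m := by exact_mod_cast P.pos
    have h0 := Int.emod_nonneg i hm.ne'
    have h1 := Int.emod_lt_of_pos i hm
    have := h ⟨(i % m).toNat, by omega⟩
    rw [arcStart_toCircleGon_add_one] at this
    simp only [toCircleGon, Int.toNat_of_nonneg h0] at this
    rwa [circlePoint_pt_emod, circlePoint_pt_emod] at this
  · rw [arcStart_toCircleGon_add_one]
    exact h (i : ℕ)

end PeriodicGon

namespace CircleGon

variable {m : ℕ} [NeZero m] (P : CircleGon m)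

theorem natCast_pos : (0 : ℤ) < m := by exact_mod_cast Nat.pos_of_neZero m

/-- The index of a periodically continued arc. -/
def idx (m : ℕ) [NeZero m] (i : ℤ) : Fin m :=
  ⟨(i % m).toNat, by
    have h := natCast_pos (m := m)
    have := Int.emod_lt_of_pos i h
    omega⟩

theorem coe_idx (i : ℤ) : ((idx m i : ℕ) : ℤ) = i % m :=
  Int.toNat_of_nonneg (Int.emod_nonneg i natCast_pos.ne')

noncomputable def liftStart (i : ℤ) : ℝ := P.arcStart (idx m i) + 2 * Real.pi * (i / m : ℤ)

noncomputable def liftEnd (i : ℤ) : ℝ := P.arcEnd (idx m i) + 2 * Real.pi * (i / m : ℤ)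

theorem idx_add_one (i : ℤ) : idx m (i + 1) = idx m i + 1 := by
  refine Fin.ext ?_
  zify
  rw [coe_idx, Fin.val_add, Fin.val_one', Nat.add_mod_mod]
  push_cast
  rw [coe_idx, Int.emod_add_emod]

theorem idx_add_turn (i : ℤ) : idx m (i + m) = idx m i := by
  refine Fin.ext ?_
  zify
  rw [coe_idx, coe_idx, Int.add_emod_right]

theorem succ_cases (i : ℤ) :
    ((i + 1) / m = i / m ∧ idx m i < idx m (i + 1)) ∨
    ((i + 1) / m = i / m + 1 ∧ (idx m (i + 1) : ℕ) = 0 ∧ (idx m i : ℕ) + 1 = m) := by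
  have hm : (0 : ℤ) < m := natCast_pos
  have h0 := Int.emod_nonneg i hm.ne'
  have h1 := Int.emod_lt_of_pos i hm
  have h2 := Int.emod_add_mul_ediv i m
  have c1 := coe_idx (m := m) i
  have c2 := coe_idx (m := m) (i + 1)
  rcases lt_or_ge (i % (m : ℤ) + 1) m with h | h
  · obtain ⟨e1, e2⟩ := (Int.ediv_emod_unique hm (a := i + 1) (r := i % m + 1) (q := i / m)).2
      ⟨by linarith, by omega, h⟩
    refine .inl ⟨e1, Fin.lt_def.2 ?_⟩
    omega
  · obtain ⟨e1, e2⟩ := (Int.ediv_emod_unique hm (a := i + 1) (r := 0) (q := i / m + 1)).2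
      ⟨by rw [mul_add]; omega, le_rfl, hm⟩
    exact .inr ⟨e1, by omega, by omega⟩

theorem liftStart_le_liftEnd (i : ℤ) : P.liftStart i ≤ P.liftEnd i :=
  add_le_add_left (P.start_le_end _) _

theorem liftEnd_lt_liftStart (i : ℤ) : P.liftEnd i < P.liftStart (i + 1) := by
  rw [liftEnd, liftStart]
  rcases succ_cases (m := m) i with ⟨h1, h2⟩ | ⟨h1, h2, h3⟩
  · rw [h1]
    linarith [P.end_lt_start _ _ h2]
  · rw [h1]
    push_cast
    linarith [P.end_lt_turn (idx m i) (idx m (i + 1))]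

theorem liftStart_lt_turn (i : ℤ) : P.liftStart (i + 1) < P.liftEnd i + 2 * Real.pi := by
  rw [liftEnd, liftStart]
  rcases succ_cases (m := m) i with ⟨h1, h2⟩ | ⟨h1, h2, h3⟩
  · rw [h1]
    linarith [P.end_lt_turn (idx m (i + 1)) (idx m i), P.start_le_end (idx m (i + 1)),
      P.start_le_end (idx m i)]
  · rw [h1]
    push_cast
    suffices P.arcStart (idx m (i + 1)) < P.arcEnd (idx m i) by linarith
    -- Index `0` is also the last one only if there is a single arc. Then `chord_ne` is what keeps
    -- the gap from being a full turn.
    rcases Nat.eq_zero_or_pos (idx m i : ℕ) with h0 | h0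
    · have he : idx m (i + 1) = idx m i := Fin.ext (by omega)
      have := P.chord_ne (idx m i)
      rw [← idx_add_one, he] at this
      rw [he]
      exact (P.start_le_end _).lt_of_ne fun e => this (by rw [e])
    · have := P.end_lt_start (idx m (i + 1)) (idx m i) (Fin.lt_def.2 (by omega))
      linarith [P.start_le_end (idx m (i + 1)), P.start_le_end (idx m i)]

theorem liftStart_add_turn (i : ℤ) : P.liftStart (i + m) = P.liftStart i + 2 * Real.pi := by
  rw [liftStart, liftStart, idx_add_turn, Int.add_ediv_of_dvd_right (dvd_refl _),
    Int.ediv_self natCast_pos.ne']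
  push_cast; ring

theorem liftEnd_add_turn (i : ℤ) : P.liftEnd (i + m) = P.liftEnd i + 2 * Real.pi := by
  rw [liftEnd, liftEnd, idx_add_turn, Int.add_ediv_of_dvd_right (dvd_refl _),
    Int.ediv_self natCast_pos.ne']
  push_cast; ring

noncomputable def unroll (j : ℤ) : ℝ :=
  if j % 2 = 0 then P.liftStart (j / 2) else P.liftEnd (j / 2)

theorem unroll_even (i : ℤ) : P.unroll (2 * i) = P.liftStart i := by
  rw [unroll, if_pos (by omega), show 2 * i / 2 = i by omega]

theorem unroll_odd (i : ℤ) : P.unroll (2 * i + 1) = P.liftEnd i := by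
  rw [unroll, if_neg (by omega), show (2 * i + 1) / 2 = i by omega]

theorem unroll_even_succ (i : ℤ) : P.unroll (2 * i + 2) = P.liftStart (i + 1) := by
  rw [← unroll_even, mul_add, mul_one]

noncomputable def toPeriodicGon : PeriodicGon m where
  pt := P.unroll
  pt_add_turn j := by
    obtain ⟨i, rfl | rfl⟩ := Int.even_or_odd' j
    · rw [← mul_add, unroll_even, unroll_even, liftStart_add_turn]
    · rw [add_right_comm, ← mul_add, unroll_odd, unroll_odd, liftEnd_add_turn]
  start_le_end i := by
    rw [unroll_even, unroll_odd]; exact P.liftStart_le_liftEnd i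
  end_lt_start i := by
    rw [unroll_odd, unroll_even_succ]; exact P.liftEnd_lt_liftStart i
  start_lt_turn i := by
    rw [unroll_odd, unroll_even_succ]; exact P.liftStart_lt_turn i

theorem region_toPeriodicGon : P.toPeriodicGon.region = P.region := by
  ext z
  refine and_congr_right fun _ => ?_
  have key : ∀ i : ℤ,
      z ∈ leftSide (circlePoint (P.toPeriodicGon.pt (2 * i + 1)))
        (circlePoint (P.toPeriodicGon.pt (2 * i + 2))) ↔
      z ∈ leftSide (circlePoint (P.arcEnd (idx m i)))
        (circlePoint (P.arcStart (idx m i + 1))) := by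
    intro i
    simp only [toPeriodicGon]
    rw [unroll_odd, unroll_even_succ, liftEnd, liftStart, circlePoint_add_two_pi_mul,
      circlePoint_add_two_pi_mul, idx_add_one]
  refine ⟨fun h i => ?_, fun h i => (key i).2 (h _)⟩
  have hi : idx m ((i : ℕ) : ℤ) = i := by
    refine Fin.ext ?_
    zify
    rw [coe_idx, Int.emod_eq_of_lt (by omega) (by exact_mod_cast i.2)]
  have := (key ((i : ℕ) : ℤ)).1 (h _)
  rwa [hi] at this

end CircleGon

theorem isCircleGon_iff {k : ℕ} {D : Set ℂ} :
    IsCircleGon k D ↔ ∃ (m : ℕ) (P : PeriodicGon m), m ≤ k ∧ D = P.region := by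
  constructor
  · rintro ⟨m, _, P, hm, rfl⟩
    exact ⟨m, P.toPeriodicGon, hm, P.region_toPeriodicGon.symm⟩
  · rintro ⟨m, P, hm, rfl⟩
    have : NeZero m := ⟨P.pos.ne'⟩
    exact ⟨m, this, P.toCircleGon, hm, P.region_toCircleGon.symm⟩

/-! ### Disjointness seen from a base point -/

/-- A circle-gon together with a base point outside its corners: `parity` is `1` if the base point
lies on an arc. -/
structure BasedGon (β : ℝ) where
  sides : ℕ
  gon : PeriodicGon sides
  parity : ℕ
  parity_le : parity ≤ 1
  lt_base : gon.pt (parity - 1) < β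
  base_lt : β < gon.pt parity

namespace BasedGon

variable {β : ℝ} (C D : BasedGon β)

/-- The number of letters that represent a circle-gon. -/
def size : ℕ := 2 * C.sides + C.parity

theorem lt_parity {j : ℤ} (h : C.gon.pt j ≤ β) : j < C.parity := by
  by_contra hn
  have := C.gon.monotone_pt (not_lt.1 hn)
  linarith [C.base_lt]

theorem parity_le_of_le {j : ℤ} (h : β ≤ C.gon.pt j) : C.parity ≤ j := by
  by_contra hn
  have := C.gon.monotone_pt (show j ≤ C.parity - 1 by omega)
  linarith [C.lt_base]

/-- From the base point on, `D` lies in a gap of `C` that has an arc of `C` before it. -/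
def Follows : Prop := D.parity = 0 ∧ ∃ i : ℕ, i < C.sides ∧
  C.gon.pt (2 * i + 1) < D.gon.pt 0 ∧ D.gon.pt (2 * D.sides - 1) < C.gon.pt (2 * i + 2)

variable {C D}

/-- If `Q` lies in a gap of `P`, then the rest of the circle, which carries `P`, lies in the gap of
`Q` after its last arc there. -/
theorem gap_symm {m n : ℕ} {P : PeriodicGon m} {Q : PeriodicGon n} {i j : ℤ}
    (h1 : P.pt (2 * i + 1) < Q.pt (2 * j)) (h2 : Q.pt (2 * j + 2 * n - 1) < P.pt (2 * i + 2)) :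
    Q.pt (2 * (j + n - 1) + 1) < P.pt (2 * (i + 1)) ∧
      P.pt (2 * (i + 1) + 2 * m - 1) < Q.pt (2 * (j + n - 1) + 2) := by
  have e1 := P.pt_add_turn (2 * i + 1)
  have e2 := Q.pt_add_turn (2 * j)
  rw [show 2 * (j + (n : ℤ) - 1) + 1 = 2 * j + 2 * n - 1 by ring,
    show 2 * (i + 1) = 2 * i + 2 by ring,
    show 2 * i + 2 + 2 * (m : ℤ) - 1 = 2 * i + 1 + 2 * m by ring,
    show 2 * (j + (n : ℤ) - 1) + 2 = 2 * j + 2 * n by ring]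
  exact ⟨h2, by linarith⟩

theorem follows_of_base_lt {i j : ℤ} (h1 : C.gon.pt (2 * i + 1) < D.gon.pt (2 * j))
    (h2 : D.gon.pt (2 * j + 2 * D.sides - 1) < C.gon.pt (2 * i + 2))
    (h3 : C.gon.pt (2 * i + 1) ≤ β) (h4 : β ≤ D.gon.pt (2 * j + 2 * D.sides - 1)) :
    Follows D C := by
  have p1 := C.parity_le
  have p2 := D.parity_le
  have a1 := C.lt_parity h3
  have a2 := C.parity_le_of_le (h4.trans h2.le)
  -- The base point lies in gap `i` of `C`. By the numbering this is the gap just before index `0`,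
  -- and `C.parity = 0`.
  obtain rfl : i = -1 := by omega
  have e1 := C.gon.pt_add_turn (2 * (-1) + 1)
  have e2 := D.gon.pt_add_turn (2 * j)
  have e3 := D.gon.pt_add_turn (2 * j - 1)
  have e4 := C.gon.start_lt_turn (-1)
  rw [show 2 * j - 1 + 2 * (D.sides : ℤ) = 2 * j + 2 * D.sides - 1 by ring] at e3
  have a3 := D.lt_parity (j := 2 * j - 1) (by linarith)
  have a4 := D.parity_le_of_le h4
  refine ⟨by omega, (j + D.sides - 1).toNat, by omega, ?_⟩
  rw [Int.toNat_of_nonneg (by omega),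
    show 2 * (j + (D.sides : ℤ) - 1) + 1 = 2 * j + 2 * D.sides - 1 by ring,
    show 2 * (j + (D.sides : ℤ) - 1) + 2 = 2 * j + 2 * D.sides by ring,
    show 2 * (C.sides : ℤ) - 1 = 2 * (-1) + 1 + 2 * C.sides by ring]
  exact ⟨h2, by linarith⟩

theorem exists_gap_of_follows (h : Follows C D) : ∃ i j : ℤ,
    C.gon.pt (2 * i + 1) < D.gon.pt (2 * j) ∧
      D.gon.pt (2 * j + 2 * D.sides - 1) < C.gon.pt (2 * i + 2) := by
  obtain ⟨-, i, -, h1, h2⟩ := h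
  exact ⟨i, 0, by simpa using h1, by simpa using h2⟩

theorem not_inter_region_nonempty_iff :
    ¬ (C.gon.region ∩ D.gon.region).Nonempty ↔ Follows C D ∨ Follows D C := by
  rw [PeriodicGon.not_inter_region_nonempty_iff]
  constructor
  · rintro ⟨i, j, h1, h2⟩
    have hπ := Real.two_pi_pos
    -- The whole configuration is turned until the base point lies within one turn after the left
    -- end of the gap.
    obtain ⟨t, ht, ht'⟩ : ∃ t : ℤ, C.gon.pt (2 * i + 1) + 2 * Real.pi * t ≤ β ∧
        β < C.gon.pt (2 * i + 1) + 2 * Real.pi * (t + 1) := by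
      refine ⟨⌊(β - C.gon.pt (2 * i + 1)) / (2 * Real.pi)⌋, ?_, ?_⟩
      · have := Int.floor_le ((β - C.gon.pt (2 * i + 1)) / (2 * Real.pi))
        rw [le_div_iff₀ hπ] at this
        linarith
      · have := Int.lt_floor_add_one ((β - C.gon.pt (2 * i + 1)) / (2 * Real.pi))
        rw [div_lt_iff₀ hπ] at this
        linarith
    have e1 := C.gon.pt_add_turns (2 * i + 1) t
    have e2 := C.gon.pt_add_turns (2 * i + 2) t
    have e3 := D.gon.pt_add_turns (2 * j) t
    have e4 := D.gon.pt_add_turns (2 * j + 2 * D.sides - 1) t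
    rw [show 2 * i + 1 + 2 * C.sides * t = 2 * (i + C.sides * t) + 1 by ring] at e1
    rw [show 2 * i + 2 + 2 * C.sides * t = 2 * (i + C.sides * t) + 2 by ring] at e2
    rw [show 2 * j + 2 * D.sides * t = 2 * (j + D.sides * t) by ring] at e3
    rw [show 2 * j + 2 * D.sides - 1 + 2 * D.sides * t =
      2 * (j + D.sides * t) + 2 * D.sides - 1 by ring] at e4
    set i' := i + C.sides * t
    set j' := j + D.sides * t
    rcases le_or_gt β (D.gon.pt (2 * j' + 2 * D.sides - 1)) with hc | hc
    -- If `D` ends at or after the base point, the gap of `C` contains it; otherwise the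
    -- complementary gap of `D` does, and the same lemma applies with the roles exchanged.
    · exact .inr (follows_of_base_lt (by linarith) (by linarith) (by linarith) hc)
    · obtain ⟨g1, g2⟩ := gap_symm (P := C.gon) (Q := D.gon) (i := i') (j := j') (by linarith)
        (by linarith)
      refine .inl (follows_of_base_lt g1 g2 ?_ ?_)
      · rw [show 2 * (j' + (D.sides : ℤ) - 1) + 1 = 2 * j' + 2 * D.sides - 1 by ring]
        exact hc.le
      · rw [show 2 * (i' + 1) + 2 * (C.sides : ℤ) - 1 = 2 * i' + 1 + 2 * C.sides by ring,
          C.gon.pt_add_turn]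
        linarith
  · rintro (h | h)
    · exact exists_gap_of_follows h
    · obtain ⟨i, j, h1, h2⟩ := exists_gap_of_follows h
      exact ⟨_, _, gap_symm h1 h2⟩

end BasedGon

theorem PeriodicGon.exists_basedGon {m : ℕ} (P : PeriodicGon m) {β : ℝ} (hβ : ∀ j, P.pt j ≠ β) :
    ∃ C : BasedGon β, C.sides = m ∧ C.gon.region = P.region := by
  obtain ⟨j, hj, hj'⟩ := P.exists_pt_le_lt β
  have hj := hj.lt_of_ne (hβ j)
  obtain ⟨i, rfl | rfl⟩ := Int.even_or_odd' j
  · exact ⟨⟨m, P.shift i, 1, le_rfl, by simpa [shift] using hj,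
      by simpa [shift, add_comm] using hj'⟩, rfl, P.region_shift i⟩
  · refine ⟨⟨m, P.shift (i + 1), 0, zero_le_one, ?_, ?_⟩, rfl, P.region_shift _⟩
    · simp only [shift, Nat.cast_zero]
      rwa [show 0 - 1 + 2 * (i + 1) = 2 * i + 1 by ring]
    · simp only [shift, Nat.cast_zero]
      rwa [show 0 + 2 * (i + 1) = 2 * i + 1 + 1 by ring]

/-! ### The dictionary between letters and corners -/

theorem countP_eq_card {K ι : Type*} [DecidableEq K] {l : List K} (hl : l.Nodup) (p : K → Bool)
    {T : Finset ι} {c : ι → K} (hc : Set.InjOn c T)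
    (h : ∀ z, z ∈ l ∧ p z = true ↔ ∃ t ∈ T, c t = z) : l.countP p = T.card := by
  rw [List.countP_eq_length_filter, ← List.toFinset_card_of_nodup (hl.filter _),
    ← Finset.card_image_of_injOn hc]
  congr 1
  ext z
  rw [List.mem_toFinset, List.mem_filter, h, Finset.mem_image]

/-- As `c` increases, the indices with `c t < z` form an initial segment, so their number determines
them. -/
theorem card_filter_lt_eq_iff {K : Type*} [LinearOrder K] {c : ℕ → K} {n x : ℕ}
    (hc : StrictMonoOn c (Set.Iio n)) (z : K) :
    ((Finset.range n).filter (fun t => c t < z)).card = x ↔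
      x ≤ n ∧ (∀ t < x, c t < z) ∧ ∀ t, x ≤ t → t < n → ¬ c t < z := by
  constructor
  · rintro rfl
    set T := (Finset.range n).filter (fun t => c t < z) with hT
    have hmem : ∀ t, t ∈ T ↔ t < n ∧ c t < z := fun t => by rw [hT]; simp
    have hdown : ∀ s t, s ≤ t → t ∈ T → s ∈ T := fun s t hst ht => by
      rw [hmem] at ht ⊢
      exact ⟨hst.trans_lt ht.1,
        (hc.monotoneOn (show s < n from hst.trans_lt ht.1) ht.1 hst).trans_lt ht.2⟩
    have hlt : ∀ t, t ∈ T ↔ t < T.card := by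
      intro t
      constructor
      · intro ht
        have : Finset.range (t + 1) ⊆ T := fun s hs =>
          hdown s t (Nat.lt_succ_iff.1 (Finset.mem_range.1 hs)) ht
        simpa using Finset.card_le_card this
      · intro ht
        by_contra hn
        have : T ⊆ Finset.range t := fun s hs => Finset.mem_range.2 <| by
          by_contra hts
          exact hn (hdown t s (not_lt.1 hts) hs)
        have := Finset.card_le_card this
        rw [Finset.card_range] at this
        omega
    refine ⟨?_, fun t ht => ((hmem t).1 ((hlt t).2 ht)).2, fun t h1 h2 h3 => ?_⟩
    · simpa using Finset.card_filter_le (Finset.range n) (fun t => c t < z)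
    · exact absurd ((hlt t).1 ((hmem t).2 ⟨h2, h3⟩)) (not_lt.2 h1)
  · rintro ⟨h1, h2, h3⟩
    rw [← Finset.card_range x]
    congr 1
    ext t
    rw [Finset.mem_filter, Finset.mem_range, Finset.mem_range]
    refine ⟨fun ⟨a, b⟩ => ?_, fun h => ⟨h.trans_le h1, h2 t h⟩⟩
    by_contra hn
    exact h3 t (not_lt.1 hn) a b

/-- The elements of `l` with label `v` are, in increasing order, `c 0`, ..., `c (n - 1)`. -/
def Enumerates {K V : Type*} [LinearOrder K] (l : List K) (label : K → V) (v : V) (n : ℕ)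
    (c : ℕ → K) : Prop :=
  StrictMonoOn c (Set.Iio n) ∧ ∀ z, z ∈ l ∧ label z = v ↔ ∃ t < n, c t = z

namespace Enumerates

variable {K V : Type*} [LinearOrder K] [DecidableEq V] {l : List K} {label : K → V} {v : V} {n : ℕ}
  {c : ℕ → K}

theorem count_eq (h : Enumerates l label v n c) (hl : l.SortedLT) :
    (l.map label).count v = n := by
  rw [List.count, List.countP_map]
  have := countP_eq_card hl.nodup ((fun x => x == v) ∘ label) (T := Finset.range n) (c := c)
    (by simpa using h.1.injOn) (fun z => by simpa using h.2 z)
  simpa using this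

theorem countP_lt (h : Enumerates l label v n c) (hl : l.SortedLT) (z : K) :
    l.countP (fun t => label t = v ∧ t < z) =
      ((Finset.range n).filter (fun t => c t < z)).card := by
  refine countP_eq_card hl.nodup _ (c := c) (h.1.injOn.mono fun t => by simp; tauto) fun y => ?_
  rw [decide_eq_true_iff, ← and_assoc, h.2]
  constructor
  · rintro ⟨⟨t, ht, rfl⟩, hz⟩
    exact ⟨t, by simp [ht, hz], rfl⟩
  · rintro ⟨t, ht, rfl⟩
    rw [Finset.mem_filter, Finset.mem_range] at ht
    exact ⟨⟨t, ht.1, rfl⟩, ht.2⟩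

end Enumerates

/-- The relative order of corners of opposite kinds is that of the corresponding letters. -/
def OrderCompatible {β : ℝ} {K : Type*} [LinearOrder K] (C D : BasedGon β) (c d : ℕ → K) : Prop :=
  ∀ s t, s < C.size → t < D.size → Odd s → Even t → D.parity ≤ t →
    (c s < d t ↔ C.gon.pt s < D.gon.pt t)

/-- The even prefix has length `2(i + 1)`, so it ends with the end of arc `i`. Only the comparisons
of this letter with the first letter of `b`, and of the last letter of `b` with the next start,
matter. Each compares an end with a start, and neither involves the extra letter for a base point on
an arc, which therefore may stand for any angle. -/
theorem blockAfterEven_iff_follows {β : ℝ} {K V : Type*} [LinearOrder K] [DecidableEq V] {l : List K}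
    (hl : l.SortedLT) {label : K → V} {a b : V} (hab : a ≠ b) {C D : BasedGon β} {c d : ℕ → K}
    (hc : Enumerates l label a C.size c) (hd : Enumerates l label b D.size d)
    (hcd : OrderCompatible C D c d) (hdc : OrderCompatible D C d c) :
    BlockAfterEven a b (l.map label) ↔ C.Follows D := by
  have hC := C.gon.pos
  have hD := D.gon.pos
  have pC := C.parity_le
  have pD := D.parity_le
  have sC : C.size = 2 * C.sides + C.parity := rfl
  have sD : D.size = 2 * D.sides + D.parity := rfl
  have hne : ∀ s < C.size, ∀ t < D.size, c s ≠ d t := fun s hs t ht e => by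
    have h1 := ((hc.2 _).2 ⟨s, hs, rfl⟩).2
    have h2 := ((hd.2 _).2 ⟨t, ht, rfl⟩).2
    rw [e, h2] at h1
    exact hab h1.symm
  have hseen : ∀ x, EachSeen a b x 0 (l.map label) ↔
      ∀ t < D.size, x ≤ C.size ∧ (∀ s < x, c s < d t) ∧ ∀ s, x ≤ s → s < C.size → ¬ c s < d t := by
    intro x
    rw [eachSeen_map_iff label x 0 hl]
    constructor
    · intro h t ht
      have hz := (hd.2 _).2 ⟨t, ht, rfl⟩
      have := h _ hz.1 hz.2
      rw [zero_add, hc.countP_lt hl, card_filter_lt_eq_iff hc.1] at this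
      exact this
    · intro h z hz hzb
      obtain ⟨t, ht, rfl⟩ := (hd.2 z).1 ⟨hz, hzb⟩
      rw [zero_add, hc.countP_lt hl, card_filter_lt_eq_iff hc.1]
      exact h t ht
  rw [BlockAfterEven, hd.count_eq hl]
  simp only [hseen]
  constructor
  · rintro ⟨he, x, hx, hx2, h⟩
    have p0 : D.parity = 0 := by
      rw [sD] at he
      obtain ⟨r, hr⟩ := he
      omega
    obtain ⟨r, rfl⟩ := even_iff_exists_two_mul.1 hx
    obtain ⟨i, rfl⟩ : ∃ i, r = i + 1 := ⟨r - 1, by omega⟩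
    obtain ⟨h1, h2, -⟩ := h 0 (by omega)
    obtain ⟨-, -, h3⟩ := h (2 * D.sides - 1) (by omega)
    refine ⟨p0, i, by omega, ?_, ?_⟩
    · have := (hcd (2 * i + 1) 0 (by omega) (by omega) ⟨i, rfl⟩ (by simp) (by omega)).1
        (h2 _ (by omega))
      simpa using this
    · rcases lt_or_ge (2 * i + 2) C.size with hlt | hge
      · have := (hdc (2 * D.sides - 1) (2 * i + 2) (by omega) hlt ⟨D.sides - 1, by omega⟩
          ⟨i + 1, by omega⟩ (by omega)).1
            (lt_of_le_of_ne (not_lt.1 (h3 _ (by omega) hlt)) (hne _ hlt _ (by omega)).symm)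
        rw [Nat.cast_sub (by omega)] at this
        simpa using this
      -- All letters `a` precede the block. The next start of `C` is `C.pt 0` one turn later, hence
      -- beyond `β + 2π`, while `D` ends before `β + 2π`.
      · have e0 : C.parity = 0 := by omega
        have b0 := C.base_lt
        have b1 := D.lt_base
        have e1 := C.gon.pt_add_turn 0
        have e2 := D.gon.pt_add_turn (-1)
        rw [e0] at b0
        rw [p0] at b1
        simp only [Nat.cast_zero, zero_sub] at b0 b1
        rw [show (2 * (i : ℤ) + 2) = 0 + 2 * C.sides by omega,
          show (2 * (D.sides : ℤ) - 1) = -1 + 2 * D.sides by ring]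
        linarith
  · rintro ⟨p0, i, hi, h1, h2⟩
    refine ⟨by rw [sD, p0, add_zero]; exact even_two_mul _, 2 * (i + 1), even_two_mul _, by omega,
      fun t ht => ⟨by omega, fun s hs => ?_, fun s hs hs' => ?_⟩⟩
    · have k1 : c (2 * i + 1) < d 0 :=
        (hcd (2 * i + 1) 0 (by omega) (by omega) ⟨i, rfl⟩ (by simp) (by omega)).2 (by simpa using h1)
      have k2 : c s ≤ c (2 * i + 1) := hc.1.monotoneOn (show s < C.size by omega)
        (show 2 * i + 1 < C.size by omega) (by omega)
      have k3 : d 0 ≤ d t := hd.1.monotoneOn (show 0 < D.size by omega) ht (by omega)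
      exact k2.trans_lt (k1.trans_le k3)
    · have k1 : d (2 * D.sides - 1) < c (2 * i + 2) :=
        (hdc (2 * D.sides - 1) (2 * i + 2) (by omega) (by omega) ⟨D.sides - 1, by omega⟩
          ⟨i + 1, by omega⟩ (by omega)).2 (by
            rw [Nat.cast_sub (by omega)]
            simpa using h2)
      have k2 : c (2 * i + 2) ≤ c s := hc.1.monotoneOn (show 2 * i + 2 < C.size by omega) hs'
        (by omega)
      have k3 : d t ≤ d (2 * D.sides - 1) := hd.1.monotoneOn ht
        (show 2 * D.sides - 1 < D.size by omega) (by omega)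
      exact not_lt.2 (k3.trans (k1.le.trans k2))

theorem exists_enumerates {K V : Type*} [LinearOrder K] [DecidableEq V] {l : List K}
    (hl : l.Nodup) (label : K → V) {v : V} (hv : v ∈ l.map label) :
    ∃ c, Enumerates l label v ((l.map label).count v) c := by
  set T := (l.filter (fun z => label z = v)).toFinset with hT
  have hn : T.card = (l.map label).count v := by
    rw [hT, List.toFinset_card_of_nodup (hl.filter _), List.count, List.countP_map,
      List.countP_eq_length_filter]
    rfl
  have hpos : 0 < (l.map label).count v := List.count_pos_iff.2 hv
  set e := T.orderEmbOfFin hn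
  refine ⟨fun t => if h : t < (l.map label).count v then e ⟨t, h⟩ else e ⟨0, hpos⟩, ?_, fun z => ?_⟩
  · intro s hs t ht hst
    simp only [Set.mem_Iio] at hs ht
    simp only [hs, ht, dif_pos]
    exact e.strictMono hst
  · have hz : (z ∈ l ∧ label z = v) ↔ z ∈ T := by simp [hT]
    rw [hz, ← Finset.mem_coe, ← Finset.range_orderEmbOfFin T hn]
    constructor
    · rintro ⟨t, rfl⟩
      exact ⟨t, t.2, by simp [e]⟩
    · rintro ⟨t, ht, rfl⟩
      exact ⟨⟨t, ht⟩, by simp [ht, e]⟩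

/-! ### From words to circle-gons -/

/-- The periodic continuation of a sequence that is read from index `r` on. -/
noncomputable def periodicExtension (x : ℕ → ℝ) (m r : ℕ) (j : ℤ) : ℝ :=
  x (r + ((j - r) % (2 * m : ℤ)).toNat) + 2 * Real.pi * ((j - r) / (2 * m : ℤ) : ℤ)

theorem periodicExtension_natCast (x : ℕ → ℝ) {m r t : ℕ} (h1 : r ≤ t) (h2 : t < r + 2 * m) :
    periodicExtension x m r t = x t := by
  have e1 : ((t : ℤ) - r) % (2 * m : ℤ) = t - r := Int.emod_eq_of_lt (by omega) (by omega)
  have e2 : ((t : ℤ) - r) / (2 * m : ℤ) = 0 := Int.ediv_eq_zero_of_lt (by omega) (by omega)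
  rw [periodicExtension, e1, e2, show r + ((t : ℤ) - r).toNat = t by omega]
  simp

theorem periodicExtension_add_turn (x : ℕ → ℝ) {m : ℕ} (hm : 0 < m) (r : ℕ) (j : ℤ) :
    periodicExtension x m r (j + 2 * m) = periodicExtension x m r j + 2 * Real.pi := by
  rw [periodicExtension, periodicExtension, show j + 2 * (m : ℤ) - r = j - r + 2 * m by ring,
    Int.add_emod_right, Int.add_ediv_of_dvd_right (dvd_refl _), Int.ediv_self (by omega)]
  push_cast; ring

/-- Inside a turn this is the monotonicity of `x`; from one turn to the next it holds because all
values lie strictly between `0` and `2π`. -/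
theorem strictMono_periodicExtension {x : ℕ → ℝ} {m r : ℕ} (hm : 0 < m)
    (hx : StrictMonoOn x (Set.Iio (2 * m + r))) (h0 : ∀ t < 2 * m + r, 0 < x t)
    (h1 : ∀ t < 2 * m + r, x t < 2 * Real.pi) : StrictMono (periodicExtension x m r) := by
  refine strictMono_int_of_lt_succ fun j => ?_
  have hm' : (0 : ℤ) < 2 * m := by omega
  have b0 := Int.emod_nonneg (j - r) hm'.ne'
  have b1 := Int.emod_lt_of_pos (j - r) hm'
  have b2 := Int.emod_add_mul_ediv (j - r) (2 * m)
  rw [periodicExtension, periodicExtension]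
  rcases lt_or_ge ((j - r) % (2 * m : ℤ) + 1) (2 * m) with h | h
  · obtain ⟨e1, e2⟩ := (Int.ediv_emod_unique hm' (a := j + 1 - r) (r := (j - r) % (2 * m) + 1)
      (q := (j - r) / (2 * m))).2 ⟨by linarith, by omega, h⟩
    rw [e1, e2]
    gcongr
    exact hx (show _ < 2 * m + r by omega) (show _ < 2 * m + r by omega) (by omega)
  · obtain ⟨e1, e2⟩ := (Int.ediv_emod_unique hm' (a := j + 1 - r) (r := 0)
      (q := (j - r) / (2 * m) + 1)).2 ⟨by rw [mul_add]; omega, le_rfl, hm'⟩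
    rw [e1, e2]
    have := h1 (r + ((j - r) % (2 * m : ℤ)).toNat) (by omega)
    have := h0 (r + (0 : ℤ).toNat) (by simp; omega)
    rw [Int.cast_add, Int.cast_one, mul_add, mul_one]
    linarith

/-- The circle-gon that a set of letter positions encodes. -/
noncomputable def BasedGon.ofSeq {x : ℕ → ℝ} {m r : ℕ} (hm : 0 < m) (hr : r ≤ 1)
    (hx : StrictMonoOn x (Set.Iio (2 * m + r))) (h0 : ∀ t < 2 * m + r, 0 < x t)
    (h1 : ∀ t < 2 * m + r, x t < 2 * Real.pi) : BasedGon 0 where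
  sides := m
  gon :=
    { pt := periodicExtension x m r
      pt_add_turn := periodicExtension_add_turn x hm r
      start_le_end := fun i => (strictMono_periodicExtension hm hx h0 h1 (by omega)).le
      end_lt_start := fun i => strictMono_periodicExtension hm hx h0 h1 (by omega)
      start_lt_turn := fun i => by
        rw [← periodicExtension_add_turn x hm]
        exact strictMono_periodicExtension hm hx h0 h1 (by omega) }
  parity := r
  parity_le := hr
  lt_base := by
    have e := periodicExtension_add_turn x hm r (r - 1)
    have e' := periodicExtension_natCast x (m := m) (r := r) (t := r + 2 * m - 1) (by omega)
      (by omega)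
    rw [show (r : ℤ) - 1 + 2 * m = ((r + 2 * m - 1 : ℕ) : ℤ) by omega, e'] at e
    have := h1 (r + 2 * m - 1) (by omega)
    show periodicExtension x m r (r - 1) < 0
    linarith
  base_lt := by
    show 0 < periodicExtension x m r r
    rw [periodicExtension_natCast x le_rfl (by omega)]
    exact h0 _ (by omega)

open Real in
-- Position `p` is sent to the angle `2π(p + 1)/(N + 1)`, so the base point `0` is never a corner.
-- If `n` is odd, the first letter only records that the base point lies on an arc, and its angle is
-- discarded.
theorem exists_basedGon_of_enumerates {N n : ℕ} (hn : 2 ≤ n) {c : ℕ → Fin N}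
    (hc : StrictMonoOn c (Set.Iio n)) : ∃ C : BasedGon 0, C.size = n ∧ C.sides = n / 2 ∧
      ∀ t < n, C.parity ≤ t → C.gon.pt t = 2 * π * ((c t : ℕ) + 1) / (N + 1) := by
  have hπ := Real.pi_pos
  have hN : (0 : ℝ) < N + 1 := by positivity
  have hs : 2 * (n / 2) + n % 2 = n := Nat.div_add_mod n 2
  refine ⟨BasedGon.ofSeq (x := fun t => 2 * π * ((c t : ℕ) + 1) / (N + 1)) (m := n / 2)
    (r := n % 2) (by omega) (by omega) ?_ ?_ ?_, hs, rfl, fun t ht ht' => ?_⟩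
  · rw [hs]
    intro s hs t ht hst
    have : ((c s : ℕ) : ℝ) < (c t : ℕ) := by exact_mod_cast hc hs ht hst
    simp only
    gcongr
  · intro t _
    positivity
  · intro t _
    have : ((c t : ℕ) : ℝ) < N := by exact_mod_cast (c t).2
    rw [div_lt_iff₀ hN]
    gcongr
  · exact periodicExtension_natCast (fun t => 2 * π * ((c t : ℕ) + 1) / (N + 1)) (m := n / 2)
      (r := n % 2) ht' (by omega)

open Real in
theorem orderCompatible_of_eq {N : ℕ} {C D : BasedGon 0} {c d : ℕ → Fin N}
    (hC : ∀ t < C.size, C.parity ≤ t → C.gon.pt t = 2 * π * ((c t : ℕ) + 1) / (N + 1))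
    (hD : ∀ t < D.size, D.parity ≤ t → D.gon.pt t = 2 * π * ((d t : ℕ) + 1) / (N + 1)) :
    OrderCompatible C D c d := by
  intro s t hs ht ho he hp
  have hπ := Real.pi_pos
  have hN : (0 : ℝ) < N + 1 := by positivity
  rw [hC s hs (C.parity_le.trans ho.pos), hD t ht hp, div_lt_div_iff_of_pos_right hN,
    mul_lt_mul_iff_right₀ (by positivity), add_lt_add_iff_right, Nat.cast_lt, Fin.lt_def]

theorem isCircleGonGraphPlusIsolated_of_isRepresentable {V : Type u} {k : ℕ} {G : SimpleGraph V}
    (h : IsRepresentable (circleGonLanguage k) G) : IsCircleGonGraphPlusIsolated k G := by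
  classical
  obtain ⟨w, hw, hadj⟩ := h
  have hadj : ∀ a b, a ≠ b → (G.Adj a b ↔
      (2 ≤ w.count a ∧ w.count a ≤ 2 * k + 1) ∧ (2 ≤ w.count b ∧ w.count b ≤ 2 * k + 1) ∧
        ¬ BlockAfterEven a b w ∧ ¬ BlockAfterEven b a w) := by
    intro a b hab
    rw [hadj a b hab, ← pairProjection_mem_circleGonLanguage hab]
  have hmap : (List.finRange w.length).map w.get = w := List.map_get_finRange w
  have hsort : (List.finRange w.length).SortedLT := List.sortedLT_finRange _
  have hex : ∀ v : {v | 2 ≤ w.count v ∧ w.count v ≤ 2 * k + 1}, ∃ (c : ℕ → Fin w.length)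
      (C : BasedGon 0), Enumerates (List.finRange w.length) w.get v C.size c ∧ C.sides ≤ k ∧
      ∀ t < C.size, C.parity ≤ t →
        C.gon.pt t = 2 * Real.pi * ((c t : ℕ) + 1) / (w.length + 1) := by
    rintro ⟨v, hv2, hvk⟩
    obtain ⟨c, hc⟩ := exists_enumerates (List.nodup_finRange w.length) w.get (v := v)
      (by rw [hmap]; exact hw v)
    rw [hmap] at hc
    obtain ⟨C, h1, h2, h3⟩ := exists_basedGon_of_enumerates hv2 hc.1
    rw [← h1] at hc h3
    exact ⟨c, C, hc, by omega, h3⟩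
  choose c C hc hk hpt using hex
  refine ⟨_, ⟨fun v => (C v).gon.region,
    fun v => isCircleGon_iff.2 ⟨_, _, hk v, rfl⟩, fun a b hab => ?_⟩, fun v hv x hvx => ?_⟩
  · have hab' : (a : V) ≠ b := fun e => hab (Subtype.ext e)
    have e1 := blockAfterEven_iff_follows hsort hab' (hc a) (hc b)
      (orderCompatible_of_eq (hpt a) (hpt b)) (orderCompatible_of_eq (hpt b) (hpt a))
    have e2 := blockAfterEven_iff_follows hsort hab'.symm (hc b) (hc a)
      (orderCompatible_of_eq (hpt b) (hpt a)) (orderCompatible_of_eq (hpt a) (hpt b))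
    rw [hmap] at e1 e2
    rw [← not_iff_not, BasedGon.not_inter_region_nonempty_iff, SimpleGraph.comap_adj,
      ← e1, ← e2]
    have := hadj a b hab'
    have ha := a.2
    have hb := b.2
    simp only [Set.mem_ofPred_eq] at ha hb
    simp only [Function.Embedding.subtype_apply]
    tauto
  · exact hv ((hadj v x hvx.ne).1 hvx).1

/-! ### From circle-gons to words -/

namespace BasedGon

variable {β : ℝ}

/-- The sort key of a letter. Starts of arcs precede ends of arcs at the same point. -/
noncomputable def key (C : BasedGon β) (t : ℕ) : ℝ ×ₗ ℕ :=
  toLex (if t < C.parity then β else C.gon.pt t, t % 2)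

theorem strictMono_key (C : BasedGon β) : StrictMono C.key := by
  refine strictMono_nat_of_lt_succ fun t => ?_
  have hp := C.parity_le
  rw [key, key, Prod.Lex.toLex_lt_toLex, if_neg (by omega : ¬ t + 1 < C.parity)]
  split_ifs with h
  · refine .inl (C.base_lt.trans_le (C.gon.monotone_pt (by omega)))
  · push_cast
    rcases Nat.even_or_odd' t with ⟨i, rfl | rfl⟩
    · have := C.gon.start_le_end i
      push_cast
      rcases this.eq_or_lt with e | e
      · exact .inr ⟨e, show 2 * i % 2 < (2 * i + 1) % 2 by omega⟩
      · exact .inl e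
    · have := C.gon.end_lt_start i
      left
      push_cast
      rwa [add_assoc]

/-- Arcs are closed: if an end and a start coincide, the regions meet, and the start must come first
so that the letters do not look separated. The parity in the key arranges this before the
tie-breaker `κ` is consulted. -/
theorem orderCompatible_key {κ : Type*} [LinearOrder κ] (C D : BasedGon β) (x y : κ) :
    OrderCompatible C D (fun t => (toLex (C.key t, x) : (ℝ ×ₗ ℕ) ×ₗ κ))
      (fun t => toLex (D.key t, y)) := by
  intro s t _ _ ho he hp
  have h1 := C.parity_le
  have h2 := ho.pos
  have h3 := Nat.odd_iff.1 ho
  have h4 := Nat.even_iff.1 he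
  simp only [Prod.Lex.toLex_lt_toLex, key, if_neg (by omega : ¬ s < C.parity),
    if_neg (by omega : ¬ t < D.parity), h3, h4]
  simp

end BasedGon

/-- The corners on the universal cover are countable in number. -/
theorem exists_real_forall_ne {ι : Type*} [Finite ι] (f : ι → ℤ → ℝ) : ∃ β, ∀ i j, f i j ≠ β := by
  have hc : (Set.range fun p : ι × ℤ => f p.1 p.2).Countable := Set.countable_range _
  obtain ⟨β, hβ⟩ := (hc.dense_compl ℝ).nonempty
  exact ⟨β, fun i j e => hβ ⟨(i, j), e⟩⟩

open Classical in
theorem exists_word_of_isCircleGonGraphPlusIsolated {V : Type u} [Finite V] {k : ℕ}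
    {G : SimpleGraph V} (h : IsCircleGonGraphPlusIsolated k G) :
    ∃ w, IsRepresentedBy (circleGonLanguage k) G w ∧ ∀ v, w.count v ≤ 2 * k + 1 := by
  obtain ⟨S, ⟨D, hD, hadj⟩, hiso⟩ := h
  choose m P hm hP using fun v => isCircleGon_iff.1 (hD v)
  obtain ⟨β, hβ⟩ := exists_real_forall_ne fun v => (P v).pt
  choose C hC hCr using fun v => (P v).exists_basedGon (hβ v)
  obtain ⟨N, ⟨e⟩⟩ := Finite.exists_equiv_fin V
  have := Fintype.ofFinite V
  -- A single letter keeps a vertex outside `S` isolated, as the language asks for at least two.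
  let n : V → ℕ := fun v => if h : v ∈ S then (C ⟨v, h⟩).size else 1
  -- The last component separates letters of different vertices and carries the label.
  let c : V → ℕ → (ℝ ×ₗ ℕ) ×ₗ Fin N := fun v t =>
    toLex (if h : v ∈ S then (C ⟨v, h⟩).key t else toLex (β, 0), e v)
  let label : (ℝ ×ₗ ℕ) ×ₗ Fin N → V := fun z => e.symm (ofLex z).2
  let T : Finset ((ℝ ×ₗ ℕ) ×ₗ Fin N) :=
    Finset.univ.biUnion fun v => (Finset.range (n v)).image (c v)
  have hl : (T.sort (· ≤ ·)).SortedLT := Finset.sortedLT_sort T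
  have hc : ∀ v, Enumerates (T.sort (· ≤ ·)) label v (n v) (c v) := by
    refine fun v => ⟨fun s hs t ht hst => ?_, fun z => ?_⟩
    · simp only [c]
      by_cases hv : v ∈ S
      · rw [dif_pos hv, dif_pos hv, Prod.Lex.toLex_lt_toLex]
        exact .inl ((C _).strictMono_key hst)
      · simp only [n, dif_neg hv, Set.mem_Iio] at hs ht
        omega
    · simp only [Finset.mem_sort, T, Finset.mem_biUnion, Finset.mem_univ, true_and,
        Finset.mem_image, Finset.mem_range]
      constructor
      · rintro ⟨⟨v', t, ht, rfl⟩, hv⟩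
        obtain rfl : v' = v := by simpa [label, c] using hv
        exact ⟨t, ht, rfl⟩
      · rintro ⟨t, ht, rfl⟩
        exact ⟨⟨v, t, ht, rfl⟩, by simp [label, c]⟩
  set w := (T.sort (· ≤ ·)).map label with hw
  have hcount : ∀ v, w.count v = n v := fun v => (hc v).count_eq hl
  have hsize : ∀ v, 2 ≤ (C v).size ∧ (C v).size ≤ 2 * k + 1 := fun v => by
    have h1 := (C v).gon.pos
    have h2 := hC v
    have h3 := hm v
    have h4 := (C v).parity_le
    rw [BasedGon.size]
    omega
  have hnS : ∀ v (hv : v ∈ S), n v = (C ⟨v, hv⟩).size := fun v hv => dif_pos hv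
  have hnS' : ∀ v, v ∉ S → n v = 1 := fun v hv => dif_neg hv
  have hcS : ∀ v (hv : v ∈ S), c v = fun t => toLex ((C ⟨v, hv⟩).key t, e v) := fun v hv => by
    funext t
    simp only [c, dif_pos hv]
  refine ⟨w, ⟨fun v => ?_, fun a b hab => ?_⟩, fun v => ?_⟩
  · rw [← List.count_pos_iff, hcount]
    by_cases hv : v ∈ S
    · rw [hnS v hv]; have := hsize ⟨v, hv⟩; omega
    · rw [hnS' v hv]; omega
  · rw [pairProjection_mem_circleGonLanguage hab, hcount, hcount]
    by_cases ha : a ∈ S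
    · by_cases hb : b ∈ S
      · have ea := hc a
        have eb := hc b
        rw [hnS a ha, hcS a ha] at ea
        rw [hnS b hb, hcS b hb] at eb
        have cab := BasedGon.orderCompatible_key (C ⟨a, ha⟩) (C ⟨b, hb⟩) (e a) (e b)
        have cba := BasedGon.orderCompatible_key (C ⟨b, hb⟩) (C ⟨a, ha⟩) (e b) (e a)
        have h1 := blockAfterEven_iff_follows hl hab ea eb cab cba
        have h2 := blockAfterEven_iff_follows hl hab.symm eb ea cba cab
        have h3 := hadj ⟨a, ha⟩ ⟨b, hb⟩ (fun h => hab (congrArg Subtype.val h))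
        rw [hP, hP, ← hCr, ← hCr, ← not_iff_not, BasedGon.not_inter_region_nonempty_iff, ← h1, ← h2,
          ← hw] at h3
        simp only [SimpleGraph.comap_adj, Function.Embedding.subtype_apply] at h3
        have sa := hsize ⟨a, ha⟩
        have sb := hsize ⟨b, hb⟩
        rw [hnS a ha, hnS b hb]
        tauto
      · refine iff_of_false (fun h => hiso b hb a h.symm) fun h => ?_
        have := h.2.1.1
        rw [hnS' b hb] at this
        omega
    · refine iff_of_false (hiso a ha b) fun h => ?_
      have := h.1.1
      rw [hnS' a ha] at this
      omega
  · rw [hcount]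
    by_cases hv : v ∈ S
    · rw [hnS v hv]; exact (hsize _).2
    · rw [hnS' v hv]; omega

theorem isRepresentable_iff {V : Type u} [Finite V] {k : ℕ} {G : SimpleGraph V} :
    IsRepresentable (circleGonLanguage k) G ↔ IsCircleGonGraphPlusIsolated k G :=
  ⟨isCircleGonGraphPlusIsolated_of_isRepresentable, fun h =>
    (exists_word_of_isCircleGonGraphPlusIsolated h).imp fun _ hw => hw.1⟩

/-! ### Speed -/

theorem IsCircleGonGraph.plusIsolated {V : Type u} {k : ℕ} {G : SimpleGraph V}
    (h : IsCircleGonGraph k G) : IsCircleGonGraphPlusIsolated k G := by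
  obtain ⟨D, hD, hadj⟩ := h
  exact ⟨Set.univ, ⟨fun v => D v, fun v => hD v, fun a b hab =>
    hadj a b (fun e => hab (Subtype.ext e))⟩, fun v hv => absurd (Set.mem_univ v) hv⟩

/-- The circular segment on the arc from `a` to `b`. -/
def CircleGon.segment (a b : ℝ) (hab : a < b) (hb : b < a + 2 * Real.pi) : CircleGon 1 where
  arcStart _ := a
  arcEnd _ := b
  start_le_end _ := hab.le
  end_lt_start i j h := absurd h (by simp [Subsingleton.elim i j])
  end_lt_turn _ _ := hb
  chord_ne _ := (circlePoint_ne hab hb).symm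

theorem CircleGon.region_segment_disjoint {a b c d : ℝ} (hab : a < b) (hbc : b < c) (hcd : c < d)
    (hda : d < a + 2 * Real.pi) :
    ¬ ((segment a b hab (by linarith)).region ∩ (segment c d hcd (by linarith)).region).Nonempty := by
  rw [← region_toPeriodicGon, ← region_toPeriodicGon, PeriodicGon.not_inter_region_nonempty_iff]
  refine ⟨0, 0, ?_, ?_⟩
  · simpa [toPeriodicGon, unroll, liftEnd, liftStart, segment] using hbc
  · simpa [toPeriodicGon, unroll, liftEnd, liftStart, segment] using hda

theorem CircleGon.region_segment_nonempty {a b : ℝ} (hab : a < b) (hb : b < a + 2 * Real.pi) :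
    (segment a b hab hb).region.Nonempty := by
  rw [← region_toPeriodicGon]
  exact ⟨_, PeriodicGon.circlePoint_mem_region (i := 0) le_rfl (PeriodicGon.start_le_end _ 0)⟩

/-- The circle is cut into `M` slots of angle `δ`, and every vertex of a colour receives the same
segment, on the first half of the slot of that colour. -/
theorem isCircleGonGraph_of_colouring {V : Type u} {M k : ℕ} (hk : 1 ≤ k) (f : V → Fin M)
    {G : SimpleGraph V} (hG : ∀ a b, a ≠ b → (G.Adj a b ↔ f a = f b)) : IsCircleGonGraph k G := by
  rcases Nat.eq_zero_or_pos M with rfl | hM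
  · exact ⟨fun v => (f v).elim0, fun v => (f v).elim0, fun v => (f v).elim0⟩
  have hM' : (0 : ℝ) < M := by exact_mod_cast hM
  obtain ⟨δ, hδ, hδM⟩ : ∃ δ : ℝ, 0 < δ ∧ δ * M = 2 * Real.pi :=
    ⟨2 * Real.pi / M, by have := Real.pi_pos; positivity, div_mul_cancel₀ _ hM'.ne'⟩
  have hδ2 : δ ≤ 2 * Real.pi := by
    rw [← hδM]
    exact le_mul_of_one_le_right hδ.le (by exact_mod_cast hM)
  have h1 : ∀ i : Fin M, δ * (i : ℕ) < δ * (i : ℕ) + δ / 2 := fun i => by linarith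
  have h2 : ∀ i : Fin M, δ * (i : ℕ) + δ / 2 < δ * (i : ℕ) + 2 * Real.pi := fun i => by linarith
  have hdisj : ∀ i j : Fin M, i < j →
      ¬ ((CircleGon.segment _ _ (h1 i) (h2 i)).region ∩
        (CircleGon.segment _ _ (h1 j) (h2 j)).region).Nonempty := by
    intro i j hij
    have a1 : ((i : ℕ) : ℝ) + 1 ≤ (j : ℕ) := by exact_mod_cast hij
    have a2 : ((j : ℕ) : ℝ) + 1 ≤ M := by exact_mod_cast j.2
    have a3 : (0 : ℝ) ≤ (i : ℕ) := by positivity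
    have b1 := mul_le_mul_of_nonneg_left a1 hδ.le
    have b2 := mul_le_mul_of_nonneg_left a2 hδ.le
    have b3 := mul_nonneg hδ.le a3
    exact CircleGon.region_segment_disjoint _ (by linarith) _ (by linarith)
  refine ⟨fun v => (CircleGon.segment _ _ (h1 (f v)) (h2 (f v))).region,
    fun v => ⟨1, inferInstance, _, hk, rfl⟩, fun a b hab => ?_⟩
  rw [hG a b hab]
  constructor
  · intro h
    simp only [h, Set.inter_self]
    exact CircleGon.region_segment_nonempty _ _
  · intro h
    rcases lt_trichotomy (f a) (f b) with hlt | heq | hlt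
    · exact absurd h (hdisj _ _ hlt)
    · exact heq
    · rw [Set.inter_comm] at h
      exact absurd h (hdisj _ _ hlt)

/-- The first `m` vertices have distinct reference colours; the others choose freely among these and
one further colour. Adjacency to the reference vertices recovers each choice, the further colour
being the case of no such neighbour. -/
theorem pow_le_graphClassSpeed {k : ℕ} (hk : 1 ≤ k) {m n : ℕ} (hmn : m ≤ n) :
    (m + 1) ^ (n - m) ≤ graphClassSpeed (fun _ G => IsCircleGonGraph k G) n := by
  let col : (Fin (n - m) → Fin (m + 1)) → Fin n → Fin (m + 1) := fun g v =>
    if h : (v : ℕ) < m then ⟨v, by omega⟩ else g ⟨v - m, by omega⟩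
  let F : (Fin (n - m) → Fin (m + 1)) → SimpleGraph (Fin n) := fun g =>
    SimpleGraph.fromRel fun a b => col g a = col g b
  have hF : ∀ g a b, a ≠ b → ((F g).Adj a b ↔ col g a = col g b) := fun g a b hab => by
    simp only [F, SimpleGraph.fromRel_adj, eq_comm (a := col g b), or_self, and_iff_right hab]
  have hinj : Function.Injective F := by
    intro g g' hgg
    have key : ∀ i (j : ℕ) (hj : j < m), (g i : ℕ) = j ↔ (g' i : ℕ) = j := by
      intro i j hj
      have hne : (⟨m + i, by omega⟩ : Fin n) ≠ ⟨j, by omega⟩ := by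
        rw [Ne, Fin.mk.injEq]; omega
      have e := (hF g _ _ hne).symm.trans ((by rw [hgg] : _ ↔ _).trans (hF g' _ _ hne))
      simpa [col, hj, Fin.ext_iff] using e
    funext i
    refine Fin.ext ?_
    rcases lt_or_ge (g i : ℕ) m with h | h
    · exact ((key i _ h).1 rfl).symm
    · rcases lt_or_ge (g' i : ℕ) m with h' | h'
      · exact (key i _ h').2 rfl
      · omega
  have hsub : Set.range F ⊆ {G | IsCircleGonGraph k G} := by
    rintro _ ⟨g, rfl⟩
    exact isCircleGonGraph_of_colouring hk (col g) (hF g)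
  have := Set.ncard_le_ncard hsub (Set.toFinite _)
  rw [← Set.image_univ, Set.ncard_image_of_injective _ hinj, Set.ncard_univ] at this
  simpa [graphClassSpeed] using this

theorem graphClassSpeed_le_pow (k n : ℕ) :
    graphClassSpeed (fun _ G => IsCircleGonGraph k G) n ≤ (n + 1) ^ (n * (2 * k + 1)) := by
  set N := n * (2 * k + 1) with hN
  have hex : ∀ G : {G : SimpleGraph (Fin n) // IsCircleGonGraph k G}, ∃ w : List (Fin n),
      IsRepresentedBy (circleGonLanguage k) G.1 w ∧ w.length ≤ N := by
    intro G
    obtain ⟨w, hw, hc⟩ := exists_word_of_isCircleGonGraphPlusIsolated G.2.plusIsolated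
    refine ⟨w, hw, ?_⟩
    have h1 : ∑ a : Fin n, w.count a = w.length := by
      rw [← Multiset.coe_card, ← Multiset.sum_count_eq_card (s := Finset.univ) (by simp)]
      simp
    rw [← h1]
    refine (Finset.sum_le_card_nsmul Finset.univ _ (2 * k + 1) fun a _ => ?_).trans_eq (by simp [hN])
    refine le_of_eq_of_le ?_ (hc a)
    congr!
  choose w hw hlen using hex
  -- Reading a word with `none` beyond its end makes it a function from `Fin N` to the `n + 1`
  -- elements of `Option (Fin n)`.
  have hinj : Function.Injective fun G (i : Fin N) => (w G)[(i : ℕ)]? := by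
    intro G G' h
    have hww : w G = w G' := List.ext_getElem? fun i => by
      rcases lt_or_ge i N with hi | hi
      · exact congrFun h ⟨i, hi⟩
      · rw [List.getElem?_eq_none ((hlen G).trans hi), List.getElem?_eq_none ((hlen G').trans hi)]
    refine Subtype.ext (SimpleGraph.ext ?_)
    funext a b
    refine propext ?_
    by_cases hab : a = b
    · subst hab
      exact iff_of_false (G.1.loopless.irrefl a) (G'.1.loopless.irrefl a)
    · rw [(hw G).2 a b hab, (hw G').2 a b hab, hww]
  have := Nat.card_le_card_of_injective _ hinj
  rw [graphClassSpeed, ← Nat.card_coe_set_eq]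
  refine this.trans_eq ?_
  simp

theorem hasFactorialSpeed_isCircleGonGraph {k : ℕ} (hk : 1 ≤ k) :
    HasFactorialSpeed (fun _ G => IsCircleGonGraph k G) := by
  -- Taking `m = n / 2` gives a base of at least `√n` and an exponent of at least `n / 2`, whence `1
  -- / 4`. The factor `2` in the other constant comes from `n + 1 ≤ n ^ 2`.
  refine ⟨1 / 4, 2 * (2 * k + 1), by norm_num, by positivity, fun n hn => ⟨?_, ?_⟩⟩
  · have h1 : (((n / 2 + 1) ^ (n - n / 2) : ℕ) : ℝ) ≤
        graphClassSpeed (fun _ G => IsCircleGonGraph k G) n :=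
      Nat.cast_le.2 (pow_le_graphClassSpeed hk (Nat.div_le_self n 2))
    refine le_trans ?_ h1
    have hm : (n : ℝ) ^ (1 / 2 : ℝ) ≤ (n / 2 + 1 : ℕ) := by
      rw [← Real.sqrt_eq_rpow]
      refine Real.sqrt_le_iff.2 ⟨by positivity, ?_⟩
      have : n ≤ (n / 2 + 1) ^ 2 := by
        have : n ≤ 2 * (n / 2) + 1 := by omega
        nlinarith
      exact_mod_cast this
    have he : (1 / 2 : ℝ) * n ≤ (n - n / 2 : ℕ) := by
      have : n ≤ 2 * (n - n / 2) := by omega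
      have : (n : ℝ) ≤ 2 * (n - n / 2 : ℕ) := by exact_mod_cast this
      linarith
    calc (n : ℝ) ^ (1 / 4 * n : ℝ) = ((n : ℝ) ^ (1 / 2 : ℝ)) ^ (1 / 2 * n : ℝ) := by
          rw [← Real.rpow_mul (by positivity)]
          ring_nf
      _ ≤ ((n / 2 + 1 : ℕ) : ℝ) ^ (1 / 2 * n : ℝ) :=
          Real.rpow_le_rpow (by positivity) hm (by positivity)
      _ ≤ ((n / 2 + 1 : ℕ) : ℝ) ^ ((n - n / 2 : ℕ) : ℝ) :=
          Real.rpow_le_rpow_of_exponent_le (by exact_mod_cast Nat.le_add_left 1 _) he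
      _ = (((n / 2 + 1) ^ (n - n / 2) : ℕ) : ℝ) := by
          rw [Real.rpow_natCast, Nat.cast_pow]
  · rcases hn.eq_or_lt with rfl | hn
    -- For `n = 1` that inequality fails, but there is only one graph.
    · rw [Nat.cast_one, Real.one_rpow]
      have : graphClassSpeed (fun _ G => IsCircleGonGraph k G) 1 ≤ 1 :=
        Set.ncard_le_one_of_subsingleton _
      exact_mod_cast this
    · have h1 : n + 1 ≤ n ^ 2 := by nlinarith
      have h2 : graphClassSpeed (fun _ G => IsCircleGonGraph k G) n ≤
          n ^ (2 * (n * (2 * k + 1))) :=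
        (graphClassSpeed_le_pow k n).trans ((Nat.pow_le_pow_left h1 _).trans_eq (pow_mul _ _ _).symm)
      refine (Nat.cast_le.2 h2).trans_eq ?_
      rw [Nat.cast_pow, ← Real.rpow_natCast]
      congr 1
      push_cast
      ring

theorem mainTheorem8 (k : ℕ) (hk : 1 ≤ k) :
    Set.Finite {w : List (Fin 2) | w ∈ circleGonLanguage k} ∧
    IsZeroOneSymmetric (circleGonLanguage k) ∧
    (∀ (V : Type u) [Finite V] (G : SimpleGraph V),
      IsRepresentable (circleGonLanguage k) G ↔ IsCircleGonGraphPlusIsolated k G) ∧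
    HasFactorialSpeed (fun _ G => IsCircleGonGraph k G) :=
  ⟨finite_circleGonLanguage k, isZeroOneSymmetric_circleGonLanguage k,
    fun _ _ _ => isRepresentable_iff, hasFactorialSpeed_isCircleGonGraph hk⟩
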